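/- Let $r\in\{2,3\}$. A $T_r$-algebra is an algebra $A$ of all block upper triangular complex matrices with $r\times r$ blocks, the diagonal blocks having arbitrary sizes $d_1,\dots,d_r\ge 1$; it generates the full matrix algebra $M_N$, $N=d_1+\dots+d_r$, as a C*-algebra. A homomorphism $\alpha:A\to B$ of such algebras is star-extendible if it is the restriction of a (not necessarily unital) C*-algebra homomorphism of the generated full matrix algebras; it has multiplicity one if this extension maps rank one projections to rank one projections; and it is regular if it is a finite orthogonal direct sum of star-extendible homomorphisms of multiplicity one (the zero homomorphism being the empty sum). A regular star-extendible direct system of $T_r$-algebras is a sequence $\mathcal A=\{A_k,\alpha_k\}_{k\ge1}$ of $T_r$-algebras and regular star-extendible homomorphisms $\alpha_k:A_k\to A_{k+1}$; let $\mathcal F_r$ be the family of these systems. Systems $\mathcal A,\mathcal A'\in\mathcal F_r$ are regularly isomorphic if there are indices $1=n_0<n_1<\cdots$ and $m_0<m_1<\cdots$ and regular star-extendible homomorphisms $\phi_k:A_{n_k}\to A'_{m_k}$, $\psi_k:A'_{m_k}\to A_{n_{k+1}}$ such that $\psi_k\circ\phi_k$ and $\phi_{k+1}\circ\psi_k$ are,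 for all $k\ge 0$, the compositions $A_{n_k}\to A_{n_{k+1}}$ and $A'_{m_k}\to A'_{m_{k+1}}$ of the maps of the systems. For a $T_r$-algebra $A$, a regular partial isometry of $M_n(A)$ is a partial isometry in $M_n(A)$ whose initial and final projections lie in $M_n(A)$ and which is an orthogonal sum of rank one partial isometries with the same property. Let $v\sim w$ mean that $zvy=w$ for some unitaries $z,y$ in a sufficiently large $M_N(A)$. The dimension distribution group $G(A)$ is the Grothendieck group of the monoid of $\sim$-classes $[v]$ of regular partial isometries in $\bigcup_n M_n(A)$ with $[v]+[w]=[v\oplus w]$. Its scale $\Sigma(A)$ is the set of classes $[v]$ with $v\in A$. The matrix unit scale $S_{mu}(A)\subseteq\prod_{1\le i\le j\le r}\Sigma(A)$ is the set of all families $([\phi(e_{ij})])_{i\le j}$, where $\phi$ ranges over the regular star-extendible homomorphisms from the algebra $T_r$ of upper triangular $r\times r$ matrices, with matrix units $e_{ij}$, into $A$. For $\mathcal A\in\mathcal F_r$ let $G(\mathcal A)=\varinjlim (G(A_k),G(\alpha_k))$, where $G(\alpha_k)[v]=[\alpha_k(v)]$. Let $\Sigma(\mathcal A)$ and $S_{mu}(\mathcal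 A)$ be the unions of the images of the $\Sigma(A_k)$ and of the $S_{mu}(A_k)$, and let the positive cone $G(\mathcal A)_+$ be the semigroup (with $0$) generated by $\Sigma(\mathcal A)$. Thus $G(\mathcal A)$ is a scaled ordered group. Theorem. For $r=2$ and for $r=3$, two systems $\mathcal A,\mathcal A'\in\mathcal F_r$ are regularly isomorphic if and only if the invariants $(G(\mathcal A),S_{mu}(\mathcal A))$ and $(G(\mathcal A'),S_{mu}(\mathcal A'))$ are isomorphic, that is, if and only if there is a group isomorphism $\Phi:G(\mathcal A)\to G(\mathcal A')$ with $\Phi(G(\mathcal A)_+)=G(\mathcal A')_+$, $\Phi(\Sigma(\mathcal A))=\Sigma(\mathcal A')$ and $\Phi(S_{mu}(\mathcal A))=S_{mu}(\mathcal A')$, where $\Phi$ is applied to families coordinatewise. -/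

import Mathlib

open scoped Matrix

noncomputable section

namespace DimDist

/-! ## `T_r`-algebras and regular star-extendible homomorphisms -/

/-- The set of coordinates of an `r × r` block matrix whose `i`-th diagonal block has size
`d i ≥ 1`. -/
abbrev Idx {r : ℕ} (d : Fin r → ℕ+) : Type := Σ i : Fin r, Fin (d i)

/-- The `T_r`-algebra with block sizes `d`: all block upper triangular matrices. -/
def TAlg {r : ℕ} (d : Fin r → ℕ+) : Subalgebra ℂ (Matrix (Idx d) (Idx d) ℂ) where
  carrier := {M | M.BlockTriangular Sigma.fst}
  mul_mem' ha hb := Matrix.BlockTriangular.mul ha hb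
  add_mem' ha hb := Matrix.BlockTriangular.add ha hb
  algebraMap_mem' c := by
    rw [Algebra.algebraMap_eq_smul_one]
    intro i j hij
    rw [Matrix.smul_apply, Matrix.blockTriangular_one hij, smul_zero]

section Homs

variable {ι κ : Type} [Fintype ι] [DecidableEq ι] [Fintype κ] [DecidableEq κ]

/-- `β` is a C*-algebra homomorphism (not necessarily unital) of the full matrix algebras which
restricts to `α`. -/
def IsStarExtension {A : Subalgebra ℂ (Matrix ι ι ℂ)} {B : Subalgebra ℂ (Matrix κ κ ℂ)}
    (α : A →ₙₐ[ℂ] B) (β : Matrix ι ι ℂ →⋆ₙₐ[ℂ] Matrix κ κ ℂ) : Prop :=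
  ∀ a : A, β (a : Matrix ι ι ℂ) = (α a : Matrix κ κ ℂ)

/-- `α` is star-extendible: it is the restriction of a C*-algebra homomorphism of the generated
C*-algebras. (The C*-algebra generated by a `T_r`-algebra is the full matrix algebra.) -/
def StarExtendible {A : Subalgebra ℂ (Matrix ι ι ℂ)} {B : Subalgebra ℂ (Matrix κ κ ℂ)}
    (α : A →ₙₐ[ℂ] B) : Prop :=
  ∃ β : Matrix ι ι ℂ →⋆ₙₐ[ℂ] Matrix κ κ ℂ, IsStarExtension α β

/-- `α` is a star-extendible embedding of multiplicity one: its extension to the full matrix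
algebra maps projections of rank one to projections of rank one. -/
def MultOne {A : Subalgebra ℂ (Matrix ι ι ℂ)} {B : Subalgebra ℂ (Matrix κ κ ℂ)}
    (α : A →ₙₐ[ℂ] B) : Prop :=
  ∃ β : Matrix ι ι ℂ →⋆ₙₐ[ℂ] Matrix κ κ ℂ, IsStarExtension α β ∧
    ∀ p : Matrix ι ι ℂ, IsStarProjection p → p.rank = 1 → (β p).rank = 1

/-- `α` is regular: it is a (finite, orthogonal) direct sum of multiplicity one star-extendible
embeddings. The empty sum, that is the zero homomorphism, is allowed. -/
def IsRegular {A : Subalgebra ℂ (Matrix ι ι ℂ)} {B : Subalgebra ℂ (Matrix κ κ ℂ)}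
    (α : A →ₙₐ[ℂ] B) : Prop :=
  ∃ (k : ℕ) (θ : Fin k → (A →ₙₐ[ℂ] B)), (∀ i, MultOne (θ i)) ∧
    (∀ i j, i ≠ j → ∀ a b : A, θ i a * θ j b = 0) ∧ ∀ a : A, α a = ∑ i, θ i a

/-- Regular star-extendible homomorphisms. -/
structure IsRegStar {A : Subalgebra ℂ (Matrix ι ι ℂ)} {B : Subalgebra ℂ (Matrix κ κ ℂ)}
    (α : A →ₙₐ[ℂ] B) : Prop where
  starExtendible : StarExtendible α
  regular : IsRegular α

end Homs

/-! ## The dimension distribution group of a digraph algebra -/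

section Group

set_option linter.unusedSectionVars false

variable {ι κ : Type} [Fintype ι] [DecidableEq ι] [Fintype κ] [DecidableEq κ]
variable {A : Subalgebra ℂ (Matrix ι ι ℂ)} {B : Subalgebra ℂ (Matrix κ κ ℂ)}

/-- An element of `M_n(A)`, viewed as a complex matrix. -/
def full {n : ℕ} (v : Matrix (Fin n) (Fin n) A) : Matrix (Fin n × ι) (Fin n × ι) ℂ :=
  Matrix.comp _ _ _ _ ℂ (v.map Subtype.val)

/-- `v` is a partial isometry of `M_n(A)` whose initial and final projections belong to
`M_n(A)`. -/
def IsPisom {n : ℕ} (v : Matrix (Fin n) (Fin n) A) : Prop :=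
  (∃ p : Matrix (Fin n) (Fin n) A, full p = (full v)ᴴ * full v ∧ IsStarProjection (full p)) ∧
  (∃ q : Matrix (Fin n) (Fin n) A, full q = full v * (full v)ᴴ ∧ IsStarProjection (full q))

/-- `v` is a regular partial isometry of `M_n(A)`: a partial isometry, with initial and final
projections in `M_n(A)`, which is an orthogonal sum of rank one partial isometries of the same
kind. -/
def IsRegPisom {n : ℕ} (v : Matrix (Fin n) (Fin n) A) : Prop :=
  IsPisom v ∧ ∃ (k : ℕ) (u : Fin k → Matrix (Fin n) (Fin n) A),
    (∀ i, IsPisom (u i) ∧ (full (u i)).rank = 1) ∧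
    (∀ i j, i ≠ j → (full (u i))ᴴ * full (u j) = 0 ∧ full (u i) * (full (u j))ᴴ = 0) ∧
    v = ∑ i, u i

/-- The inclusion `M_n(A) ⊆ M_N(A)` as the upper left corner. -/
def pad {R : Type} [Zero R] {n : ℕ} (N : ℕ) (v : Matrix (Fin n) (Fin n) R) :
    Matrix (Fin N) (Fin N) R :=
  fun a b => if h : (a : ℕ) < n ∧ (b : ℕ) < n then v ⟨a, h.1⟩ ⟨b, h.2⟩ else 0

/-- The direct sum `v ⊕ w` in `M_{n+m}(A)`. -/
def dsum {R : Type} [Zero R] {n m : ℕ} (v : Matrix (Fin n) (Fin n) R)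
    (w : Matrix (Fin m) (Fin m) R) : Matrix (Fin (n + m)) (Fin (n + m)) R :=
  Matrix.reindex finSumFinEquiv finSumFinEquiv (Matrix.fromBlocks v 0 0 w)

/-- `v ∼ w` for elements `v, w` of the stable algebra `M_∞(A) = ⋃ M_n(A)`: in some sufficiently
large `M_N(A)` there are unitaries `z, y` with `z v y = w`. -/
def Equivalent {n m : ℕ} (v : Matrix (Fin n) (Fin n) A) (w : Matrix (Fin m) (Fin m) A) : Prop :=
  ∃ N : ℕ, n ≤ N ∧ m ≤ N ∧ ∃ z y : Matrix (Fin N) (Fin N) A,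
    full z ∈ Matrix.unitaryGroup (Fin N × ι) ℂ ∧ full y ∈ Matrix.unitaryGroup (Fin N × ι) ℂ ∧
    z * pad N v * y = pad N w

variable (A) in
/-- The regular partial isometries of the stable algebra `M_∞(A)`. -/
abbrev PiReg : Type := Σ n : ℕ, {v : Matrix (Fin n) (Fin n) A // IsRegPisom v}


theorem full_mul {n : ℕ} (v w : Matrix (Fin n) (Fin n) A) : full (v * w) = full v * full w := by
  have h : (v * w).map Subtype.val = v.map Subtype.val * w.map (Subtype.val : A → _) :=
    Matrix.map_mul (f := A.val.toRingHom)
  rw [full, h]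
  exact map_mul (Matrix.compRingEquiv (Fin n) ι ℂ) _ _

theorem full_add {n : ℕ} (v w : Matrix (Fin n) (Fin n) A) : full (v + w) = full v + full w := rfl

theorem full_injective {n : ℕ} :
    Function.Injective (full : Matrix (Fin n) (Fin n) A → _) := by
  intro v w h
  have h' := (Matrix.comp _ _ _ _ ℂ).injective h
  ext a b : 2
  exact congrFun (congrFun h' a) b

theorem full_one {n : ℕ} : full (1 : Matrix (Fin n) (Fin n) A) = 1 := by
  have h : (1 : Matrix (Fin n) (Fin n) A).map Subtype.val =
      (1 : Matrix (Fin n) (Fin n) (Matrix ι ι ℂ)) :=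
    Matrix.map_one _ rfl rfl
  rw [full, h]
  exact map_one (Matrix.compRingEquiv (Fin n) ι ℂ)

theorem full_zero {n : ℕ} : full (0 : Matrix (Fin n) (Fin n) A) = 0 := rfl

theorem full_dsum {n m : ℕ} (v : Matrix (Fin n) (Fin n) A) (w : Matrix (Fin m) (Fin m) A) :
    full (dsum v w) =
      Matrix.reindex ((Equiv.sumProdDistrib _ _ _).symm.trans
        (finSumFinEquiv.prodCongr (Equiv.refl ι)))
        ((Equiv.sumProdDistrib _ _ _).symm.trans
        (finSumFinEquiv.prodCongr (Equiv.refl ι)))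
        (Matrix.fromBlocks (full v) 0 0 (full w)) := by
  ext ⟨a, i⟩ ⟨b, j⟩
  obtain ⟨a, rfl⟩ := finSumFinEquiv.surjective a
  obtain ⟨b, rfl⟩ := finSumFinEquiv.surjective b
  simp only [full, dsum, Matrix.comp_apply, Matrix.map_apply, Matrix.reindex_apply,
    Matrix.submatrix_apply, Equiv.symm_apply_apply, Equiv.symm_trans_apply, Equiv.symm_symm,
    Equiv.prodCongr_symm, Equiv.prodCongr_apply, Prod.map_apply, Equiv.refl_symm, Equiv.refl_apply]
  rcases a with a | a <;> rcases b with b | b <;> simp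

theorem full_dsum_conjTranspose_mul {n m : ℕ} (v v' : Matrix (Fin n) (Fin n) A)
    (w w' : Matrix (Fin m) (Fin m) A) (p : Matrix (Fin n) (Fin n) A)
    (q : Matrix (Fin m) (Fin m) A) (hp : full p = (full v)ᴴ * full v')
    (hq : full q = (full w)ᴴ * full w') :
    full (dsum p q) = (full (dsum v w))ᴴ * full (dsum v' w') := by
  simp only [full_dsum, hp, hq, Matrix.reindex_apply, Matrix.conjTranspose_submatrix,
    Matrix.submatrix_mul_equiv, Matrix.fromBlocks_conjTranspose, Matrix.fromBlocks_multiply]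
  simp

theorem full_dsum_mul_conjTranspose {n m : ℕ} (v v' : Matrix (Fin n) (Fin n) A)
    (w w' : Matrix (Fin m) (Fin m) A) (p : Matrix (Fin n) (Fin n) A)
    (q : Matrix (Fin m) (Fin m) A) (hp : full p = full v * (full v')ᴴ)
    (hq : full q = full w * (full w')ᴴ) :
    full (dsum p q) = full (dsum v w) * (full (dsum v' w'))ᴴ := by
  simp only [full_dsum, hp, hq, Matrix.reindex_apply, Matrix.conjTranspose_submatrix,
    Matrix.submatrix_mul_equiv, Matrix.fromBlocks_conjTranspose, Matrix.fromBlocks_multiply]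
  simp

theorem dsum_zero_zero {n m : ℕ} :
    dsum (0 : Matrix (Fin n) (Fin n) A) (0 : Matrix (Fin m) (Fin m) A) = 0 := by
  simp [dsum]

theorem dsum_add {n m : ℕ} (v v' : Matrix (Fin n) (Fin n) A) (w w' : Matrix (Fin m) (Fin m) A) :
    dsum (v + v') (w + w') = dsum v w + dsum v' w' := by
  have h : Matrix.fromBlocks (v + v') 0 0 (w + w') =
      Matrix.fromBlocks v 0 0 w + Matrix.fromBlocks v' 0 0 w' := by
    simp [Matrix.fromBlocks_add]
  rw [dsum, h]
  rfl

theorem isStarProjection_full_dsum {n m : ℕ} {p : Matrix (Fin n) (Fin n) A}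
    {q : Matrix (Fin m) (Fin m) A} (hp : IsStarProjection (full p))
    (hq : IsStarProjection (full q)) : IsStarProjection (full (dsum p q)) := by
  have hp1 : full p * full p = full p := hp.isIdempotentElem
  have hq1 : full q * full q = full q := hq.isIdempotentElem
  have hp2 : (full p)ᴴ = full p := hp.isSelfAdjoint
  have hq2 : (full q)ᴴ = full q := hq.isSelfAdjoint
  constructor
  · rw [IsIdempotentElem, full_dsum]
    simp only [Matrix.reindex_apply, Matrix.submatrix_mul_equiv, Matrix.fromBlocks_multiply]
    simp [hp1, hq1]
  · rw [IsSelfAdjoint, full_dsum, Matrix.star_eq_conjTranspose]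
    simp only [Matrix.reindex_apply, Matrix.conjTranspose_submatrix,
      Matrix.fromBlocks_conjTranspose, hp2, hq2, Matrix.conjTranspose_zero]

theorem IsPisom.dsum {n m : ℕ} {v : Matrix (Fin n) (Fin n) A} {w : Matrix (Fin m) (Fin m) A}
    (hv : IsPisom v) (hw : IsPisom w) : IsPisom (dsum v w) := by
  obtain ⟨⟨p, hp, hp'⟩, ⟨q, hq, hq'⟩⟩ := hv
  obtain ⟨⟨s, hs, hs'⟩, ⟨t, ht, ht'⟩⟩ := hw
  exact ⟨⟨_, full_dsum_conjTranspose_mul _ _ _ _ _ _ hp hs, isStarProjection_full_dsum hp' hs'⟩,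
    ⟨_, full_dsum_mul_conjTranspose _ _ _ _ _ _ hq ht, isStarProjection_full_dsum hq' ht'⟩⟩

theorem isPisom_zero {n : ℕ} : IsPisom (0 : Matrix (Fin n) (Fin n) A) :=
  ⟨⟨0, by simp [full_zero], by simp [full_zero]⟩, ⟨0, by simp [full_zero], by simp [full_zero]⟩⟩

/-- The rank of a star projection is its trace. -/
theorem rank_eq_trace {m : Type} [Fintype m] [DecidableEq m] {p : Matrix m m ℂ}
    (hp : IsIdempotentElem p) : (p.rank : ℂ) = p.trace := by
  have h : IsIdempotentElem (Matrix.toLin' p) := by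
    rw [IsIdempotentElem, Module.End.mul_eq_comp, ← Matrix.toLin'_mul, hp.eq]
  have h2 := (LinearMap.isProj_range_iff_isIdempotentElem _).2 h
  rw [← Matrix.trace_toLin'_eq, h2.trace]
  rfl

theorem rank_eq_one_iff {n : ℕ} {v p : Matrix (Fin n) (Fin n) A}
    (hp : full p = (full v)ᴴ * full v) (h : IsStarProjection (full p)) :
    (full v).rank = 1 ↔ (full p).trace = 1 := by
  have h1 : (full v).rank = (full p).rank := by
    open scoped ComplexOrder in rw [hp, Matrix.rank_conjTranspose_mul_self]
  rw [h1, ← rank_eq_trace h.isIdempotentElem]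
  norm_cast

theorem trace_full_dsum {n m : ℕ} (v : Matrix (Fin n) (Fin n) A) (w : Matrix (Fin m) (Fin m) A) :
    (full (dsum v w)).trace = (full v).trace + (full w).trace := by
  have h : (Matrix.fromBlocks (full v) 0 0 (full w)).trace = (full v).trace + (full w).trace := by
    simp [Matrix.trace, Fintype.sum_sum_type]
  rw [full_dsum, ← h]
  exact Equiv.sum_comp _ fun x => Matrix.fromBlocks (full v) 0 0 (full w) x x

/-- An orthogonal decomposition into rank one partial isometries, over any finite index set. -/
theorem isRegPisom_of_decomposition {n : ℕ} {v : Matrix (Fin n) (Fin n) A} (hv : IsPisom v)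
    {J : Type} [Fintype J] (u : J → Matrix (Fin n) (Fin n) A)
    (h1 : ∀ i, IsPisom (u i) ∧ (full (u i)).rank = 1)
    (h2 : ∀ i j, i ≠ j → (full (u i))ᴴ * full (u j) = 0 ∧ full (u i) * (full (u j))ᴴ = 0)
    (h3 : v = ∑ i, u i) : IsRegPisom v := by
  let e := (Fintype.equivFin J).symm
  refine ⟨hv, Fintype.card J, u ∘ e, fun i => h1 _, fun i j hij => h2 _ _ ?_, ?_⟩
  · exact fun h => hij (e.injective h)
  · rw [h3]
    exact (Equiv.sum_comp e u).symm

theorem IsRegPisom.dsum {n m : ℕ} {v : Matrix (Fin n) (Fin n) A} {w : Matrix (Fin m) (Fin m) A}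
    (hv : IsRegPisom v) (hw : IsRegPisom w) : IsRegPisom (dsum v w) := by
  obtain ⟨hv0, k, u, hu1, hu2, hu3⟩ := hv
  obtain ⟨hw0, l, t, ht1, ht2, ht3⟩ := hw
  let D1 : Matrix (Fin n) (Fin n) A →+ Matrix (Fin (n + m)) (Fin (n + m)) A :=
    { toFun := fun x => DimDist.dsum x 0
      map_zero' := dsum_zero_zero
      map_add' := fun x y => by rw [← dsum_add, add_zero] }
  let D2 : Matrix (Fin m) (Fin m) A →+ Matrix (Fin (n + m)) (Fin (n + m)) A :=
    { toFun := fun x => DimDist.dsum 0 x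
      map_zero' := dsum_zero_zero
      map_add' := fun x y => by rw [← dsum_add, add_zero] }
  refine isRegPisom_of_decomposition (hv0.dsum hw0) (J := Fin k ⊕ Fin l)
    (Sum.elim (fun i => D1 (u i)) (fun i => D2 (t i))) ?_ ?_ ?_
  · rintro (i | i)
    · refine ⟨(hu1 i).1.dsum isPisom_zero, ?_⟩
      obtain ⟨p, hp, hp'⟩ := (hu1 i).1.1
      have h0 : full (0 : Matrix (Fin m) (Fin m) A) = (full (0 : Matrix (Fin m) (Fin m) A))ᴴ * full (0 : Matrix (Fin m) (Fin m) A) := by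
        simp [full_zero]
      have h0' : IsStarProjection (full (0 : Matrix (Fin m) (Fin m) A)) := by simp [full_zero]
      have h := (rank_eq_one_iff hp hp').1 (hu1 i).2
      refine (rank_eq_one_iff (full_dsum_conjTranspose_mul _ _ _ _ _ _ hp h0)
        (isStarProjection_full_dsum hp' h0')).2 ?_
      rw [trace_full_dsum, h, full_zero, Matrix.trace_zero, add_zero]
    · refine ⟨isPisom_zero.dsum (ht1 i).1, ?_⟩
      obtain ⟨p, hp, hp'⟩ := (ht1 i).1.1
      have h0 : full (0 : Matrix (Fin n) (Fin n) A) = (full (0 : Matrix (Fin n) (Fin n) A))ᴴ * full (0 : Matrix (Fin n) (Fin n) A) := by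
        simp [full_zero]
      have h0' : IsStarProjection (full (0 : Matrix (Fin n) (Fin n) A)) := by simp [full_zero]
      have h := (rank_eq_one_iff hp hp').1 (ht1 i).2
      refine (rank_eq_one_iff (full_dsum_conjTranspose_mul _ _ _ _ _ _ h0 hp)
        (isStarProjection_full_dsum h0' hp')).2 ?_
      rw [trace_full_dsum, h, full_zero, Matrix.trace_zero, zero_add]
  · have key1 : ∀ (x x' : Matrix (Fin n) (Fin n) A) (y y' : Matrix (Fin m) (Fin m) A),
        (full x)ᴴ * full x' = 0 → (full y)ᴴ * full y' = 0 →
        (full (DimDist.dsum x y))ᴴ * full (DimDist.dsum x' y') = 0 := by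
      intro x x' y y' hx hy
      rw [← full_dsum_conjTranspose_mul x x' y y' 0 0 (by rw [hx, full_zero])
        (by rw [hy, full_zero]), dsum_zero_zero, full_zero]
    have key2 : ∀ (x x' : Matrix (Fin n) (Fin n) A) (y y' : Matrix (Fin m) (Fin m) A),
        full x * (full x')ᴴ = 0 → full y * (full y')ᴴ = 0 →
        full (DimDist.dsum x y) * (full (DimDist.dsum x' y'))ᴴ = 0 := by
      intro x x' y y' hx hy
      rw [← full_dsum_mul_conjTranspose x x' y y' 0 0 (by rw [hx, full_zero])
        (by rw [hy, full_zero]), dsum_zero_zero, full_zero]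
    rintro (i | i) (j | j) hij
    · have h := hu2 i j (fun h => hij (by rw [h]))
      exact ⟨key1 _ _ _ _ h.1 (by simp [full_zero]), key2 _ _ _ _ h.2 (by simp [full_zero])⟩
    · exact ⟨key1 _ _ _ _ (by simp [full_zero]) (by simp [full_zero]),
        key2 _ _ _ _ (by simp [full_zero]) (by simp [full_zero])⟩
    · exact ⟨key1 _ _ _ _ (by simp [full_zero]) (by simp [full_zero]),
        key2 _ _ _ _ (by simp [full_zero]) (by simp [full_zero])⟩
    · have h := ht2 i j (fun h => hij (by rw [h]))
      exact ⟨key1 _ _ _ _ (by simp [full_zero]) h.1, key2 _ _ _ _ (by simp [full_zero]) h.2⟩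
  · rw [Fintype.sum_sum_type]
    simp only [Sum.elim_inl, Sum.elim_inr, ← map_sum, ← hu3, ← ht3]
    change DimDist.dsum v w = DimDist.dsum v 0 + DimDist.dsum 0 w
    rw [← dsum_add, add_zero, zero_add]

variable (A) in
/-- The relations `[v ⊕ w] = [v] + [w]`, and `[v] = [w]` whenever `v ∼ w`. -/
inductive Relation : FreeAbelianGroup (PiReg A) → Prop
  | dsum (v w : PiReg A) : Relation (FreeAbelianGroup.of ⟨v.1 + w.1, _, v.2.2.dsum w.2.2⟩ -
      (FreeAbelianGroup.of v + FreeAbelianGroup.of w))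
  | equiv (v w : PiReg A) (h : Equivalent v.2.1 w.2.1) :
      Relation (FreeAbelianGroup.of v - FreeAbelianGroup.of w)

variable (A) in
/-- The dimension distribution group `G(A)`: the Grothendieck group of the commutative monoid of
`∼`-classes `[v]` of regular partial isometries of the stable algebra of `A`, with addition
`[v] + [w] = [v ⊕ w]`, presented by generators and relations. -/
def G : Type := FreeAbelianGroup (PiReg A) ⧸ AddSubgroup.closure {x | Relation A x}

instance : AddCommGroup (G A) :=
  inferInstanceAs (AddCommGroup
    (FreeAbelianGroup (PiReg A) ⧸ AddSubgroup.closure {x | Relation A x}))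

/-- The class in `G(A)` of a regular partial isometry of the stable algebra. -/
def clsPi (v : PiReg A) : G A :=
  QuotientAddGroup.mk' (AddSubgroup.closure {x | Relation A x}) (FreeAbelianGroup.of v)

/-- An element of `A` as an element of `M_1(A)`. -/
def one1 (a : A) : Matrix (Fin 1) (Fin 1) A := fun _ _ => a

/-- The class `[v]` in `G(A)` of a regular partial isometry `v` of `A`. -/
def cls (v : A) (hv : IsRegPisom (one1 v)) : G A := clsPi ⟨1, one1 v, hv⟩

variable (A) in
/-- The scale of `G(A)`: the classes of the regular partial isometries of `A` itself. -/
def scale : Set (G A) := {g | ∃ (v : A) (hv : IsRegPisom (one1 v)), g = cls v hv}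

/-! ### Functoriality -/

/-- The ampliation of a C*-homomorphism to `n × n` matrices. -/
def amp (β : Matrix ι ι ℂ →⋆ₙₐ[ℂ] Matrix κ κ ℂ) (n : ℕ) (X : Matrix (Fin n × ι) (Fin n × ι) ℂ) :
    Matrix (Fin n × κ) (Fin n × κ) ℂ :=
  Matrix.comp _ _ _ _ ℂ (((Matrix.comp _ _ _ _ ℂ).symm X).map β)

theorem amp_mul (β : Matrix ι ι ℂ →⋆ₙₐ[ℂ] Matrix κ κ ℂ) (n : ℕ)
    (X Y : Matrix (Fin n × ι) (Fin n × ι) ℂ) : amp β n (X * Y) = amp β n X * amp β n Y := by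
  have h1 : (Matrix.comp _ _ _ _ ℂ).symm (X * Y) =
      (Matrix.comp (Fin n) (Fin n) ι ι ℂ).symm X * (Matrix.comp _ _ _ _ ℂ).symm Y :=
    map_mul (Matrix.compRingEquiv (Fin n) ι ℂ).symm X Y
  rw [amp, h1]
  have h2 : ((Matrix.comp (Fin n) (Fin n) ι ι ℂ).symm X * (Matrix.comp _ _ _ _ ℂ).symm Y).map β =
      ((Matrix.comp (Fin n) (Fin n) ι ι ℂ).symm X).map β *
        ((Matrix.comp (Fin n) (Fin n) ι ι ℂ).symm Y).map β := by
    ext a b : 2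
    simp [Matrix.mul_apply, map_sum]
  rw [h2]
  exact map_mul (Matrix.compRingEquiv (Fin n) κ ℂ) _ _

theorem amp_conjTranspose (β : Matrix ι ι ℂ →⋆ₙₐ[ℂ] Matrix κ κ ℂ) (n : ℕ)
    (X : Matrix (Fin n × ι) (Fin n × ι) ℂ) : amp β n Xᴴ = (amp β n X)ᴴ := by
  ext ⟨a, i⟩ ⟨b, j⟩
  have h : (Matrix.comp (Fin n) (Fin n) ι ι ℂ).symm Xᴴ a b =
      star ((Matrix.comp (Fin n) (Fin n) ι ι ℂ).symm X b a) := rfl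
  simp only [amp, Matrix.comp_apply, Matrix.map_apply, h, map_star, Matrix.conjTranspose_apply]
  rfl

theorem amp_zero (β : Matrix ι ι ℂ →⋆ₙₐ[ℂ] Matrix κ κ ℂ) (n : ℕ) : amp β n 0 = 0 := by
  ext ⟨a, i⟩ ⟨b, j⟩
  have h : (Matrix.comp (Fin n) (Fin n) ι ι ℂ).symm 0 a b = 0 := rfl
  simp [amp, h]

theorem full_map {α : A →ₙₐ[ℂ] B} {β : Matrix ι ι ℂ →⋆ₙₐ[ℂ] Matrix κ κ ℂ}
    (h : IsStarExtension α β) {n : ℕ} (v : Matrix (Fin n) (Fin n) A) :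
    full (v.map α) = amp β n (full v) := by
  ext ⟨a, i⟩ ⟨b, j⟩
  exact congrFun (congrFun (h (v a b)).symm i) j

theorem isStarProjection_amp {β : Matrix ι ι ℂ →⋆ₙₐ[ℂ] Matrix κ κ ℂ} {n : ℕ}
    {X : Matrix (Fin n × ι) (Fin n × ι) ℂ} (h : IsStarProjection X) :
    IsStarProjection (amp β n X) := by
  constructor
  · rw [IsIdempotentElem, ← amp_mul, h.isIdempotentElem.eq]
  · rw [IsSelfAdjoint, Matrix.star_eq_conjTranspose, ← amp_conjTranspose,
      ← Matrix.star_eq_conjTranspose, h.isSelfAdjoint.star_eq]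

theorem IsPisom.map {α : A →ₙₐ[ℂ] B} (hα : StarExtendible α) {n : ℕ}
    {v : Matrix (Fin n) (Fin n) A} (hv : IsPisom v) : IsPisom (v.map α) := by
  obtain ⟨β, hβ⟩ := hα
  obtain ⟨⟨p, hp, hp'⟩, ⟨q, hq, hq'⟩⟩ := hv
  refine ⟨⟨p.map α, ?_, ?_⟩, ⟨q.map α, ?_, ?_⟩⟩
  · rw [full_map hβ, full_map hβ, hp, amp_mul, amp_conjTranspose]
  · rw [full_map hβ]
    exact isStarProjection_amp hp'
  · rw [full_map hβ, full_map hβ, hq, amp_mul, amp_conjTranspose]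
  · rw [full_map hβ]
    exact isStarProjection_amp hq'

theorem trace_of_multOne {β : Matrix ι ι ℂ →⋆ₙₐ[ℂ] Matrix κ κ ℂ}
    (hβ : ∀ p : Matrix ι ι ℂ, IsStarProjection p → p.rank = 1 → (β p).rank = 1)
    (x : Matrix ι ι ℂ) : (β x).trace = x.trace := by
  have hproj : ∀ i : ι, IsStarProjection (Matrix.single i i (1 : ℂ)) := fun i =>
    ⟨by simp [IsIdempotentElem], by simp [IsSelfAdjoint, Matrix.star_eq_conjTranspose]⟩
  have hs : ∀ i j : ι, (β (Matrix.single i j (1 : ℂ))).trace =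
      (Matrix.single i j (1 : ℂ)).trace := by
    intro i j
    by_cases hij : i = j
    · subst hij
      have h1 : (Matrix.single i i (1 : ℂ)).rank = 1 := by
        have := rank_eq_trace (hproj i).isIdempotentElem
        rw [Matrix.trace_single_eq_same] at this
        exact_mod_cast this
      have h2 : IsIdempotentElem (β (Matrix.single i i (1 : ℂ))) := by
        rw [IsIdempotentElem, ← map_mul, (hproj i).isIdempotentElem.eq]
      rw [← rank_eq_trace h2, hβ _ (hproj i) h1, Matrix.trace_single_eq_same]
      norm_num
    · have h1 : Matrix.single i j (1 : ℂ) = Matrix.single i i 1 * Matrix.single i j 1 := by simp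
      have h2 : Matrix.single i j (1 : ℂ) * Matrix.single i i 1 = 0 := by
        simp [Ne.symm hij]
      rw [Matrix.trace_single_eq_of_ne _ _ _ hij, h1, map_mul, Matrix.trace_mul_comm, ← map_mul,
        h2, map_zero, Matrix.trace_zero]
  have hx : x = ∑ i, ∑ j, x i j • Matrix.single i j (1 : ℂ) := by
    conv_lhs => rw [Matrix.matrix_eq_sum_single x]
    simp [Matrix.smul_single]
  rw [hx]
  simp only [map_sum, map_smul, Matrix.trace_sum, Matrix.trace_smul, hs]

theorem rank_map_of_multOne {α : A →ₙₐ[ℂ] B} (hα : MultOne α) {n : ℕ}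
    {v : Matrix (Fin n) (Fin n) A} (hv : IsPisom v) (hr : (full v).rank = 1) :
    (full (v.map α)).rank = 1 := by
  obtain ⟨β, hβ, hβ'⟩ := hα
  obtain ⟨⟨p, hp, hp'⟩, -⟩ := hv
  have h1 : full (p.map α) = (full (v.map α))ᴴ * full (v.map α) := by
    rw [full_map hβ, full_map hβ, hp, amp_mul, amp_conjTranspose]
  have h2 : IsStarProjection (full (p.map α)) := by
    rw [full_map hβ]
    exact isStarProjection_amp hp'
  rw [rank_eq_one_iff h1 h2]
  rw [rank_eq_one_iff hp hp'] at hr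
  rw [← hr]
  simp only [Matrix.trace, Fintype.sum_prod_type, Matrix.diag_apply]
  refine Finset.sum_congr rfl fun a _ => ?_
  have h3 := trace_of_multOne hβ' (p a a : Matrix ι ι ℂ)
  rw [hβ (p a a)] at h3
  exact h3

/-- A regular star-extendible homomorphism maps regular partial isometries to regular partial
isometries. -/
theorem IsRegPisom.map {α : A →ₙₐ[ℂ] B} (hα : IsRegStar α) {n : ℕ}
    {v : Matrix (Fin n) (Fin n) A} (hv : IsRegPisom v) : IsRegPisom (v.map α) := by
  obtain ⟨hv0, k, u, hu1, hu2, hu3⟩ := hv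
  obtain ⟨K, θ, hθ1, hθ2, hθ3⟩ := hα.regular
  have hstar : ∀ i, StarExtendible (θ i) := fun i =>
    ⟨(hθ1 i).choose, (hθ1 i).choose_spec.1⟩
  have horth : ∀ (s t : Fin K), s ≠ t → ∀ x y : Matrix (Fin n) (Fin n) A,
      x.map (θ s) * y.map (θ t) = 0 := by
    intro s t hst x y
    ext a b : 1
    simp [Matrix.mul_apply, hθ2 s t hst]
  refine isRegPisom_of_decomposition (hv0.map hα.starExtendible) (J := Fin K × Fin k)
    (fun x => (u x.2).map (θ x.1)) ?_ ?_ ?_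
  · rintro ⟨s, i⟩
    exact ⟨(hu1 i).1.map (hstar s), rank_map_of_multOne (hθ1 s) (hu1 i).1 (hu1 i).2⟩
  · rintro ⟨s, i⟩ ⟨t, j⟩ hne
    by_cases hst : s = t
    · subst hst
      have hij : i ≠ j := fun h => hne (by rw [h])
      obtain ⟨β, hβ⟩ := hstar s
      simp only [full_map hβ, ← amp_conjTranspose, ← amp_mul, (hu2 i j hij).1, (hu2 i j hij).2,
        amp_zero, and_self]
    · obtain ⟨β, hβ⟩ := hstar s
      obtain ⟨γ, hγ⟩ := hstar t
      have h0 : full ((1 : Matrix (Fin n) (Fin n) A).map (θ s)) *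
          full ((1 : Matrix (Fin n) (Fin n) A).map (θ t)) = 0 := by
        rw [← full_mul, horth s t hst, full_zero]
      rw [full_map hβ, full_map hγ, full_one] at h0
      have hsa : (amp β n 1)ᴴ = amp β n 1 := by
        rw [← amp_conjTranspose, Matrix.conjTranspose_one]
      have hsa' : (amp γ n 1)ᴴ = amp γ n 1 := by
        rw [← amp_conjTranspose, Matrix.conjTranspose_one]
      have e1 : amp β n (full (u i)) = amp β n 1 * amp β n (full (u i)) := by
        rw [← amp_mul, one_mul]
      have e2 : amp γ n (full (u j)) = amp γ n 1 * amp γ n (full (u j)) := by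
        rw [← amp_mul, one_mul]
      have e3 : amp β n (full (u i)) = amp β n (full (u i)) * amp β n 1 := by
        rw [← amp_mul, mul_one]
      have e4 : amp γ n (full (u j)) = amp γ n (full (u j)) * amp γ n 1 := by
        rw [← amp_mul, mul_one]
      simp only [full_map hβ, full_map hγ]
      constructor
      · rw [e1, e2, Matrix.conjTranspose_mul, hsa, mul_assoc, ← mul_assoc (amp β n 1), h0,
          zero_mul, mul_zero]
      · rw [e3, e4, Matrix.conjTranspose_mul, hsa', mul_assoc, ← mul_assoc (amp β n 1), h0,
          zero_mul, mul_zero]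
  · ext a b : 1
    rw [hu3]
    simp [Matrix.sum_apply, Fintype.sum_prod_type, hθ3, map_sum]

theorem pad_map {n N : ℕ} (α : A →ₙₐ[ℂ] B) (v : Matrix (Fin n) (Fin n) A) :
    (pad N v).map α = pad N (v.map α) := by
  ext a b : 1
  by_cases h : (a : ℕ) < n ∧ (b : ℕ) < n <;> simp [pad, h]

theorem dsum_map {n m : ℕ} (α : A →ₙₐ[ℂ] B) (v : Matrix (Fin n) (Fin n) A)
    (w : Matrix (Fin m) (Fin m) A) : (dsum v w).map α = dsum (v.map α) (w.map α) := by
  have h : (Matrix.fromBlocks v 0 0 w).map α = Matrix.fromBlocks (v.map α) 0 0 (w.map α) := by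
    simp [Matrix.fromBlocks_map]
  rw [dsum, dsum, ← h]
  rfl

theorem map_mul_matrix {n : ℕ} (α : A →ₙₐ[ℂ] B) (x y : Matrix (Fin n) (Fin n) A) :
    (x * y).map α = x.map α * y.map α := by
  ext a b : 1
  simp [Matrix.mul_apply, map_sum]

theorem unitary_ext {α : A →ₙₐ[ℂ] B} (hα : StarExtendible α) {n : ℕ}
    {z : Matrix (Fin n) (Fin n) A} (hz : full z ∈ Matrix.unitaryGroup (Fin n × ι) ℂ) :
    full (z.map α + (1 - (1 : Matrix (Fin n) (Fin n) A).map α)) ∈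
      Matrix.unitaryGroup (Fin n × κ) ℂ := by
  obtain ⟨β, hβ⟩ := hα
  have e : full (z.map α + (1 - (1 : Matrix (Fin n) (Fin n) A).map α)) =
      amp β n (full z) + (1 - amp β n 1) := by
    have h1 := full_map hβ (1 : Matrix (Fin n) (Fin n) A)
    rw [full_one] at h1
    have h2 : full ((1 : Matrix (Fin n) (Fin n) B) - (1 : Matrix (Fin n) (Fin n) A).map α) =
      full 1 - full ((1 : Matrix (Fin n) (Fin n) A).map α) := rfl
    rw [full_add, full_map hβ, h2, h1, full_one]
  have hsa : (amp β n 1)ᴴ = amp β n 1 := by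
    rw [← amp_conjTranspose, Matrix.conjTranspose_one]
  have h11 : amp β n 1 * amp β n 1 = amp β n 1 := by rw [← amp_mul, one_mul]
  have hz1 : amp β n (full z) * amp β n 1 = amp β n (full z) := by rw [← amp_mul, mul_one]
  have hz2 : (amp β n (full z))ᴴ * amp β n 1 = (amp β n (full z))ᴴ := by
    rw [← amp_conjTranspose, ← amp_mul, mul_one]
  have hz3 : amp β n 1 * (amp β n (full z))ᴴ = (amp β n (full z))ᴴ := by
    rw [← amp_conjTranspose, ← amp_mul, one_mul]
  have hz4 : amp β n (full z) * (amp β n (full z))ᴴ = amp β n 1 := by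
    rw [← amp_conjTranspose, ← amp_mul, ← Matrix.star_eq_conjTranspose,
      Matrix.mem_unitaryGroup_iff.1 hz]
  rw [Matrix.mem_unitaryGroup_iff, Matrix.star_eq_conjTranspose, e, Matrix.conjTranspose_add,
    Matrix.conjTranspose_sub, hsa, Matrix.conjTranspose_one]
  simp only [add_mul, mul_add, sub_mul, mul_sub, one_mul, mul_one, h11, hz1, hz3, hz4]
  abel

theorem Equivalent.map {α : A →ₙₐ[ℂ] B} (hα : StarExtendible α) {n m : ℕ}
    {v : Matrix (Fin n) (Fin n) A} {w : Matrix (Fin m) (Fin m) A} (h : Equivalent v w) :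
    Equivalent (v.map α) (w.map α) := by
  obtain ⟨N, hn, hm, z, y, hz, hy, e⟩ := h
  refine ⟨N, hn, hm, _, _, unitary_ext hα hz, unitary_ext hα hy, ?_⟩
  rw [← pad_map, ← pad_map, ← e, map_mul_matrix, map_mul_matrix]
  have e1 : (1 : Matrix (Fin N) (Fin N) A).map α * (pad N v).map α = (pad N v).map α := by
    rw [← map_mul_matrix, one_mul]
  have e2 : (pad N v).map α * (1 : Matrix (Fin N) (Fin N) A).map α = (pad N v).map α := by
    rw [← map_mul_matrix, mul_one]
  have e3 : (z.map α + (1 - (1 : Matrix (Fin N) (Fin N) A).map α)) * (pad N v).map α =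
      z.map α * (pad N v).map α := by
    rw [add_mul, sub_mul, one_mul, e1, sub_self, add_zero]
  rw [e3, mul_assoc, mul_add, mul_sub, mul_one, e2, sub_self, add_zero, ← mul_assoc]

/-- The map of regular partial isometries of stable algebras induced by `α`. -/
def PiReg.map (α : A →ₙₐ[ℂ] B) (hα : IsRegStar α) (v : PiReg A) : PiReg B :=
  ⟨v.1, v.2.1.map α, v.2.2.map hα⟩

/-- The group homomorphism `G(α) : G(A) → G(B)`, `[v] ↦ [α(v)]`, induced by a regular
star-extendible homomorphism `α`. -/
def Gmap (α : A →ₙₐ[ℂ] B) (hα : IsRegStar α) : G A →+ G B :=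
  QuotientAddGroup.map _ _ (FreeAbelianGroup.map (PiReg.map α hα)) (by
    rw [AddSubgroup.closure_le]
    intro x hx
    refine AddSubgroup.subset_closure ?_
    rcases hx with ⟨v, w⟩ | ⟨v, w, h⟩
    · have h := Relation.dsum (PiReg.map α hα v) (PiReg.map α hα w)
      have e : PiReg.map α hα ⟨v.1 + w.1, _, v.2.2.dsum w.2.2⟩ =
          ⟨(PiReg.map α hα v).1 + (PiReg.map α hα w).1, _,
            (PiReg.map α hα v).2.2.dsum (PiReg.map α hα w).2.2⟩ := by
        refine Sigma.ext rfl (heq_of_eq (Subtype.ext ?_))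
        exact dsum_map α _ _
      rw [← e] at h
      change Relation B (FreeAbelianGroup.map (PiReg.map α hα) _)
      rw [map_sub, map_add, FreeAbelianGroup.map_of_apply, FreeAbelianGroup.map_of_apply,
        FreeAbelianGroup.map_of_apply]
      exact h
    · have h' := Relation.equiv (PiReg.map α hα v) (PiReg.map α hα w) (h.map hα.starExtendible)
      change Relation B (FreeAbelianGroup.map (PiReg.map α hα) _)
      rw [map_sub, FreeAbelianGroup.map_of_apply, FreeAbelianGroup.map_of_apply]
      exact h')

theorem Gmap_clsPi (α : A →ₙₐ[ℂ] B) (hα : IsRegStar α) (v : PiReg A) :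
    Gmap α hα (clsPi v) = clsPi (PiReg.map α hα v) := by
  change QuotientAddGroup.mk' _ (FreeAbelianGroup.map (PiReg.map α hα) (FreeAbelianGroup.of v)) = _
  rw [FreeAbelianGroup.map_of_apply]
  rfl

end Group

/-! ## Matrix unit scales -/

section MatrixUnitScale

/-- The edges `(i, j)`, `i ≤ j`, of the digraph of the upper triangular matrix algebra `T_r`. -/
abbrev Edge (r : ℕ) : Type := {p : Fin r × Fin r // p.1 ≤ p.2}

/-- The algebra `T_r` of upper triangular `r × r` matrices. -/
abbrev Tri (r : ℕ) : Subalgebra ℂ (Matrix (Idx fun _ : Fin r => 1) (Idx fun _ : Fin r => 1) ℂ) :=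
  TAlg fun _ => 1

/-- The matrix unit `e_{ij}` of `T_r`. -/
def unit {r : ℕ} (e : Edge r) : Tri r :=
  ⟨Matrix.single ⟨e.1.1, 0⟩ ⟨e.1.2, 0⟩ 1, fun a b hab => by
    refine Matrix.single_apply_of_ne _ _ _ _ _ fun h => ?_
    obtain ⟨rfl, rfl⟩ := h
    exact absurd e.2 (not_le.2 hab)⟩

theorem full_unit {r : ℕ} (e : Edge r) : full (one1 (unit e)) =
    Matrix.single ((0 : Fin 1), ⟨e.1.1, 0⟩) ((0 : Fin 1), ⟨e.1.2, 0⟩) (1 : ℂ) := by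
  ext ⟨a, i⟩ ⟨b, j⟩
  obtain rfl := Subsingleton.elim a 0
  obtain rfl := Subsingleton.elim b 0
  simp only [full, one1, unit, Matrix.comp_apply, Matrix.map_apply, Matrix.single_apply,
    Prod.mk.injEq, true_and]

theorem isRegPisom_unit {r : ℕ} (e : Edge r) : IsRegPisom (one1 (unit e)) := by
  have hproj : ∀ i : Fin r, IsStarProjection (full (one1 (unit ⟨(i, i), le_refl i⟩))) := fun i => by
    rw [full_unit]
    exact ⟨by simp [IsIdempotentElem], by simp [IsSelfAdjoint, Matrix.star_eq_conjTranspose]⟩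
  have h1 : full (one1 (unit ⟨(e.1.2, e.1.2), le_refl e.1.2⟩)) =
      (full (one1 (unit e)))ᴴ * full (one1 (unit e)) := by
    simp [full_unit, Matrix.conjTranspose_single]
  have h2 : full (one1 (unit ⟨(e.1.1, e.1.1), le_refl e.1.1⟩)) =
      full (one1 (unit e)) * (full (one1 (unit e)))ᴴ := by
    simp [full_unit, Matrix.conjTranspose_single]
  have h : IsPisom (one1 (unit e)) := ⟨⟨_, h1, hproj _⟩, ⟨_, h2, hproj _⟩⟩
  refine isRegPisom_of_decomposition h (J := Unit) (fun _ => one1 (unit e)) ?_ ?_ ?_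
  · refine fun _ => ⟨h, (rank_eq_one_iff h1 (hproj _)).2 ?_⟩
    rw [full_unit, Matrix.trace_single_eq_same]
  · exact fun i j hij => absurd (Subsingleton.elim i j) hij
  · simp

theorem isRegPisom_map_unit {r : ℕ} {d : Fin r → ℕ+} {φ : Tri r →ₙₐ[ℂ] TAlg d}
    (hφ : IsRegStar φ) (e : Edge r) : IsRegPisom (one1 (φ (unit e))) :=
  (isRegPisom_unit e).map hφ

/-- The matrix unit scale of a `T_r`-algebra `B`: the families `([φ(e_{ij})])_{i ≤ j}` in `G(B)`,
where `φ` ranges over the regular star-extendible homomorphisms `T_r → B`. -/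
def muScale {r : ℕ} (d : Fin r → ℕ+) : Set (Edge r → G (TAlg d)) :=
  {s | ∃ (φ : Tri r →ₙₐ[ℂ] TAlg d) (hφ : IsRegStar φ),
    s = fun e => cls (φ (unit e)) (isRegPisom_map_unit hφ e)}

end MatrixUnitScale

/-! ## Direct systems -/

/-- A regular star-extendible direct system of `T_r`-algebras. -/
structure RegSystem (r : ℕ) where
  /-- the block sizes of the algebras `A_k` -/
  dim : ℕ → Fin r → ℕ+
  /-- the homomorphisms `α_k : A_k → A_{k+1}` -/
  map : ∀ k, TAlg (dim k) →ₙₐ[ℂ] TAlg (dim (k + 1))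
  isRegStar : ∀ k, IsRegStar (map k)

namespace RegSystem

variable {r : ℕ} (S : RegSystem r)

/-- The `k`-th algebra of the system. -/
abbrev alg (k : ℕ) : Subalgebra ℂ (Matrix (Idx (S.dim k)) (Idx (S.dim k)) ℂ) := TAlg (S.dim k)

/-- The composition `A_m → A_n` of the maps of the system, for `m ≤ n`. -/
def trans {m n : ℕ} (h : m ≤ n) : S.alg m →ₙₐ[ℂ] S.alg n :=
  Nat.leRecOn (C := fun k => S.alg m →ₙₐ[ℂ] S.alg k) h (fun {k} g => (S.map k).comp g)
    (NonUnitalAlgHom.id ℂ (S.alg m))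

/-- The composition `G(A_m) → G(A_n)` of the maps `G(α_k)`, for `m ≤ n`. -/
def gTrans (m n : ℕ) (h : m ≤ n) : G (S.alg m) →+ G (S.alg n) :=
  Nat.leRecOn (C := fun k => G (S.alg m) →+ G (S.alg k)) h
    (fun {k} g => (Gmap (S.map k) (S.isRegStar k)).comp g) (AddMonoidHom.id _)

/-- The dimension distribution group of the system, the direct limit of the groups `G(A_k)`. -/
abbrev GLim : Type := AddCommGroup.DirectLimit (fun k => G (S.alg k)) S.gTrans

/-- The canonical homomorphism `G(A_k) → G(𝒜)`. -/
abbrev toGLim (k : ℕ) : G (S.alg k) →+ S.GLim :=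
  AddCommGroup.DirectLimit.of (fun k => G (S.alg k)) S.gTrans k

/-- The scale of `G(𝒜)`: the union of the images of the scales of the `G(A_k)`. -/
def scaleLim : Set S.GLim := ⋃ k, S.toGLim k '' scale (S.alg k)

/-- The positive cone of `G(𝒜)`: the semigroup generated by the scale. -/
def coneLim : AddSubmonoid S.GLim := AddSubmonoid.closure S.scaleLim

/-- The matrix unit scale of the system: the union of the images of the matrix unit scales of the
algebras `A_k`. -/
def muScaleLim : Set (Edge r → S.GLim) :=
  ⋃ k, (fun s e => S.toGLim k (s e)) '' muScale (S.dim k)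

/-- Regular isomorphism: there are subsystems `A_{n_0} → A_{n_1} → ⋯` and
`A'_{m_0} → A'_{m_1} → ⋯` (with `n_0 = 0` the first index), and regular star-extendible
homomorphisms `φ_k : A_{n_k} → A'_{m_k}` and `ψ_k : A'_{m_k} → A_{n_{k+1}}` which form a commuting
diagram with the maps of the systems. -/
def RegIso (S S' : RegSystem r) : Prop :=
  ∃ (n m : ℕ → ℕ) (hn : StrictMono n) (hm : StrictMono m)
    (φ : ∀ k, S.alg (n k) →ₙₐ[ℂ] S'.alg (m k))
    (ψ : ∀ k, S'.alg (m k) →ₙₐ[ℂ] S.alg (n (k + 1))),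
    n 0 = 0 ∧ (∀ k, IsRegStar (φ k)) ∧ (∀ k, IsRegStar (ψ k)) ∧
    (∀ k, (ψ k).comp (φ k) = S.trans (hn k.lt_succ_self).le) ∧
    (∀ k, (φ (k + 1)).comp (ψ k) = S'.trans (hm k.lt_succ_self).le)

/-- `Φ` is an isomorphism of the invariants `(G(𝒜), S_mu(𝒜))`: an isomorphism of scaled ordered
groups which maps the matrix unit scale onto the matrix unit scale. -/
structure IsInvariantIso (S S' : RegSystem r) (Φ : S.GLim ≃+ S'.GLim) : Prop where
  map_cone : Φ '' (S.coneLim : Set S.GLim) = S'.coneLim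
  map_scale : Φ '' S.scaleLim = S'.scaleLim
  map_muScale : (fun s e => Φ (s e)) '' S.muScaleLim = S'.muScaleLim

end RegSystem

end DimDist

end

open scoped Matrix

noncomputable section

namespace DimDist

/-! ## Isometries, unitaries and rank one matrices -/

section MatrixLemmas

set_option linter.unusedSectionVars false

variable {κ J R : Type} [Fintype κ] [DecidableEq κ] [Fintype J] [DecidableEq J]

/-! The proof reduces regular homomorphisms to finite counting data and then runs an Elliott
intertwining.

A multiplicity one map of `T_r`-algebras is a ↦ W a W* for an isometry W which carries block i into
block π i, with π monotone. A regular homomorphism is an orthogonal sum of such maps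
(`IsRegStar.exists_isHomRep`), so up to a block diagonal unitary it is the multiset of its maps π
(`IsHomRep.exists_unitary`); a given multiset is realised as soon as the target blocks have room
(`exists_hom_of_card_le`). In the same way a regular partial isometry is X Y* with columns in single
blocks, and its class is a sum of edge classes (`IsRep.clsPi_eq`). The multiplicities `edgeCount`
are dual to the edge classes, so G(A) is free on the edges.

Uniqueness: G(α) records, for each i ≤ j, how often the pair (π i, π j) takes each value. For r = 2
a pair is the whole map; for r = 3 monotonicity leaves so few triples that their counts can be
solved for from the pair counts (`exists_equiv_of_pair_counts`). This is where the size of r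
matters. Hence G(α) determines α up to a block diagonal unitary (`exists_unitary_of_Gmap_eq`).

Existence: the edge classes of A_k form a member of the matrix unit scale. Their image under Φ is
realised by a homomorphism from T_r, which supplies the maps π; the scale, applied to the class of
the identity, supplies the room to use the same π on A_k (`exists_lift`). Alternating lifts of Φ and
of its inverse, each corrected by a unitary, give an exactly commuting ladder (`exists_intertwiner`,
`regIso_of_mutually_inverse`). Conversely, a ladder induces mutually inverse maps of the limits by
functoriality. -/

theorem card_le_of_isometry {W : Matrix κ J ℂ} (hW : Wᴴ * W = 1) :
    Fintype.card J ≤ Fintype.card κ := by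
  have h1 := Matrix.rank_mul_le_right Wᴴ W
  rw [hW, Matrix.rank_one] at h1
  exact h1.trans (Matrix.rank_le_card_height W)

/-- An isometry is obtained from a unitary matrix by deleting columns. -/
theorem exists_unitary_submatrix (g : J ↪ κ) {W : Matrix κ J ℂ} (hW : Wᴴ * W = 1) :
    ∃ B ∈ Matrix.unitaryGroup κ ℂ, B.submatrix id g = W := by
  let w : J → EuclideanSpace ℂ κ := fun j => WithLp.toLp 2 fun x => W x j
  have hw : Orthonormal ℂ w := by
    rw [orthonormal_iff_ite]
    intro i j
    have h := congrFun (congrFun hW i) j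
    rw [Matrix.mul_apply, Matrix.one_apply] at h
    rw [← h, PiLp.inner_apply]
    refine Finset.sum_congr rfl fun x _ => ?_
    simp [w, mul_comm]
  let v : κ → EuclideanSpace ℂ κ := Function.extend g w 0
  have hv : ∀ j, v (g j) = w j := fun j => g.injective.extend_apply _ _ _
  have hvo : Orthonormal ℂ ((Set.range g).domRestrict v) := by
    let e := Equiv.ofInjective g g.injective
    have h : (Set.range g).domRestrict v = w ∘ e.symm := by
      ext1 ⟨x, j, rfl⟩
      have h2 : e.symm ⟨g j, j, rfl⟩ = j := e.symm_apply_apply j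
      simp [h2, hv]
    rw [h]
    exact hw.comp _ e.symm.injective
  obtain ⟨b, hb⟩ := hvo.exists_orthonormalBasis_extension_of_card_eq (by simp)
  refine ⟨(EuclideanSpace.basisFun κ ℂ).toBasis.toMatrix b,
    (EuclideanSpace.basisFun κ ℂ).toMatrix_orthonormalBasis_mem_unitary b, ?_⟩
  ext x j
  have h := hb (g j) ⟨j, rfl⟩
  rw [hv] at h
  simp [Module.Basis.toMatrix_apply, h, w]

/-- Two isometries with the same domain differ by a unitary. -/
theorem exists_unitary_mul_eq {W W' : Matrix κ J ℂ} (hW : Wᴴ * W = 1) (hW' : W'ᴴ * W' = 1) :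
    ∃ U ∈ Matrix.unitaryGroup κ ℂ, U * W = W' := by
  obtain ⟨g⟩ := Function.Embedding.nonempty_of_card_le (card_le_of_isometry hW)
  obtain ⟨B, hB, rfl⟩ := exists_unitary_submatrix g hW
  obtain ⟨B', hB', rfl⟩ := exists_unitary_submatrix g hW'
  -- W = B P and W' = B' P with the same column selection P, so B' B* carries W to W'.
  refine ⟨B' * star B, mul_mem hB' (Unitary.star_mem hB), ?_⟩
  have h : B.submatrix id g = B * (1 : Matrix κ κ ℂ).submatrix id g := by
    ext x j
    simp [Matrix.mul_apply, Matrix.one_apply]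
  have h' : B'.submatrix id g = B' * (1 : Matrix κ κ ℂ).submatrix id g := by
    ext x j
    simp [Matrix.mul_apply, Matrix.one_apply]
  rw [h, h', ← Matrix.mul_assoc, Matrix.mul_assoc B', Matrix.mem_unitaryGroup_iff'.1 hB,
    Matrix.mul_one]

theorem sum_subtype_of_support {p : κ → Prop} [DecidablePred p] {F : κ → ℂ}
    (h : ∀ x, F x ≠ 0 → p x) : ∑ x : {x // p x}, F x = ∑ x, F x := by
  rw [← Finset.sum_filter_of_ne fun x _ => h x]
  exact (Finset.sum_subtype _ (by simp) F).symm

/-- Compressing an isometry whose columns are supported in blocks to one block. -/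
theorem isometry_fiber [DecidableEq R] {bl : κ → R} {f : J → R} {W : Matrix κ J ℂ}
    (hW : Wᴴ * W = 1) (hs : ∀ x j, W x j ≠ 0 → bl x = f j) (b : R) :
    (W.submatrix (Subtype.val : {x // bl x = b} → κ) (Subtype.val : {j // f j = b} → J))ᴴ *
      W.submatrix (Subtype.val : {x // bl x = b} → κ) (Subtype.val : {j // f j = b} → J) = 1 := by
  ext ⟨i, hi⟩ ⟨j, hj⟩
  have h := congrFun (congrFun hW i) j
  rw [Matrix.mul_apply, Matrix.one_apply] at h
  rw [Matrix.mul_apply, Matrix.one_apply]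
  simp only [Subtype.mk.injEq, ← h]
  exact sum_subtype_of_support (p := fun x => bl x = b) (F := fun x => Wᴴ i x * W x j)
    fun x hx => (hs x j (right_ne_zero_of_mul hx)).trans hj

/-- The columns assigned to `b` are orthonormal inside that block. This is the dimension bound
behind `edgeCount_le_of_mem_scale`. -/
theorem card_fiber_le [DecidableEq R] {bl : κ → R} {f : J → R} {W : Matrix κ J ℂ}
    (hW : Wᴴ * W = 1) (hs : ∀ x j, W x j ≠ 0 → bl x = f j) (b : R) :
    Fintype.card {j // f j = b} ≤ Fintype.card {x // bl x = b} :=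
  card_le_of_isometry (isometry_fiber hW hs b)

/-- Two isometries whose columns are supported in the same blocks differ by a block diagonal
unitary. -/
theorem exists_block_unitary_mul_eq [Fintype R] [DecidableEq R] {bl : κ → R} {f : J → R}
    {W W' : Matrix κ J ℂ} (hW : Wᴴ * W = 1) (hW' : W'ᴴ * W' = 1)
    (hs : ∀ x j, W x j ≠ 0 → bl x = f j) (hs' : ∀ x j, W' x j ≠ 0 → bl x = f j) :
    ∃ U ∈ Matrix.unitaryGroup κ ℂ, (∀ x y, U x y ≠ 0 → bl x = bl y) ∧ U * W = W' := by
  -- The two compressions to block `b` have the same columns, so a unitary `V b` relates them; U is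
  -- the direct sum of the `V b` along the fibres of `bl`.
  choose V hV hVW using fun b =>
    exists_unitary_mul_eq (isometry_fiber hW hs b) (isometry_fiber hW' hs' b)
  let e := Equiv.sigmaFiberEquiv bl
  have key : ∀ (b : R) (x : {x // bl x = b}) (y : κ),
      Matrix.reindex e e (Matrix.blockDiagonal' V) x y = if h : bl y = b then V b x ⟨y, h⟩ else 0 := by
    rintro b ⟨x, rfl⟩ y
    by_cases h : bl y = bl x
    · have hy : e.symm y = ⟨bl x, y, h⟩ := by
        rw [Equiv.symm_apply_eq]; rfl
      have hx : e.symm x = ⟨bl x, x, rfl⟩ := rfl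
      simp [h, hx, hy, Matrix.blockDiagonal'_apply]
    · have hy : e.symm y = ⟨bl y, y, rfl⟩ := rfl
      have hx : e.symm x = ⟨bl x, x, rfl⟩ := rfl
      simp [h, hx, hy, Matrix.blockDiagonal'_apply, Ne.symm h]
  refine ⟨Matrix.reindex e e (Matrix.blockDiagonal' V), ?_, ?_, ?_⟩
  · rw [Matrix.mem_unitaryGroup_iff, Matrix.star_eq_conjTranspose, Matrix.reindex_apply,
      Matrix.conjTranspose_submatrix, Matrix.submatrix_mul_equiv, Matrix.blockDiagonal'_conjTranspose,
      ← Matrix.blockDiagonal'_mul]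
    have h : (fun b => V b * (V b)ᴴ) = 1 := by
      ext1 b
      exact Matrix.mem_unitaryGroup_iff.1 (hV b)
    rw [h, Matrix.blockDiagonal'_one, Matrix.submatrix_one_equiv]
  · intro x y h
    have h1 := key (bl x) ⟨x, rfl⟩ y
    by_contra hne
    exact h (h1.trans (dif_neg (Ne.symm hne)))
  · ext x j
    rw [Matrix.mul_apply]
    simp only [key (bl x) ⟨x, rfl⟩]
    by_cases hj : f j = bl x
    · have h := congrFun (congrFun (hVW (bl x)) ⟨x, rfl⟩) ⟨j, hj⟩
      rw [Matrix.mul_apply] at h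
      simp only [Matrix.submatrix_apply] at h
      rw [← h, ← sum_subtype_of_support (p := fun y => bl y = bl x)]
      · exact Finset.sum_congr rfl fun y _ => by rw [dif_pos y.2]
      · exact fun y hy => (hs y j (right_ne_zero_of_mul hy)).trans hj
    · have h2 : W' x j = 0 := by
        by_contra h
        exact hj (hs' x j h).symm
      rw [h2]
      refine Finset.sum_eq_zero fun y _ => ?_
      by_cases hy : bl y = bl x
      · have h3 : W y j = 0 := by
          by_contra h
          exact hj ((hs y j h).symm.trans hy)
        rw [h3, mul_zero]
      · rw [dif_neg hy, zero_mul]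

theorem exists_eq_vecMulVec {ι : Type} [Fintype ι] [DecidableEq ι] {u : Matrix κ ι ℂ}
    (hu : u.rank = 1) : ∃ a b, u = Matrix.vecMulVec a b := by
  obtain ⟨a, -, ha⟩ := finrank_eq_one_iff'.1 (show Module.finrank ℂ u.mulVecLin.range = 1 from hu)
  choose c hc using fun y : ι => ha ⟨u.mulVecLin (Pi.single y 1), _, rfl⟩
  refine ⟨a, c, ?_⟩
  ext x y
  have h := congrFun (congrArg Subtype.val (hc y)) x
  simp only [Submodule.coe_smul, Pi.smul_apply, smul_eq_mul, Matrix.mulVecLin_apply,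
    Matrix.mulVec_single_one, Matrix.col_apply] at h
  rw [Matrix.vecMulVec_apply, mul_comm, h]

/-- A rank one partial isometry is of the form `ξ η*` with unit vectors `ξ`, `η`. -/
theorem exists_unit_vectors {u : Matrix κ κ ℂ} (hu : u.rank = 1)
    (hp : IsIdempotentElem (uᴴ * u)) :
    ∃ ξ η : κ → ℂ, star ξ ⬝ᵥ ξ = 1 ∧ star η ⬝ᵥ η = 1 ∧ u = Matrix.vecMulVec ξ (star η) := by
  obtain ⟨a, b, rfl⟩ := exists_eq_vecMulVec hu
  have ha : a ≠ 0 := by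
    rintro rfl
    simp at hu
  have hb : b ≠ 0 := by
    rintro rfl
    simp at hu
  obtain ⟨x, hx⟩ := Function.ne_iff.1 hb
  have hA : star a ⬝ᵥ a = ((∑ i, Complex.normSq (a i) : ℝ) : ℂ) := by
    simp [dotProduct, Complex.normSq_eq_conj_mul_self]
  have hpos : 0 < ∑ i, Complex.normSq (a i) := by
    obtain ⟨y, hy⟩ := Function.ne_iff.1 ha
    exact Finset.sum_pos' (fun i _ => Complex.normSq_nonneg _)
      ⟨y, Finset.mem_univ _, Complex.normSq_pos.2 hy⟩
  generalize (∑ i, Complex.normSq (a i)) = A at hA hpos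
  have hA0 : (A : ℂ) ≠ 0 := by exact_mod_cast hpos.ne'
  -- For u = a bᵀ and A = |a|², the matrix u* u is A times the product of the conjugate of b with
  -- bᵀ. Idempotency, read at a diagonal entry where `b` does not vanish, gives A |b|² = 1.
  have hAB : (A : ℂ) * (b ⬝ᵥ star b) = 1 := by
    have h := congrFun (congrFun hp.eq x) x
    simp only [Matrix.conjTranspose_vecMulVec, Matrix.vecMulVec_mul_vecMulVec, hA,
      Matrix.vecMulVec_apply, Pi.smul_apply, smul_eq_mul, Pi.star_apply, smul_dotProduct] at h
    have hx' : star (b x) ≠ 0 := star_ne_zero.2 hx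
    have h2 : star (b x) * b x * A * ((A : ℂ) * (b ⬝ᵥ star b) - 1) = 0 := by
      linear_combination h
    have h3 := (mul_eq_zero.1 h2).resolve_left (mul_ne_zero (mul_ne_zero hx' hx) hA0)
    linear_combination h3
  have hs : ((Real.sqrt A : ℝ) : ℂ) * ((Real.sqrt A : ℝ) : ℂ) = A := by
    rw [← Complex.ofReal_mul, Real.mul_self_sqrt hpos.le]
  have hs0 : ((Real.sqrt A : ℝ) : ℂ) ≠ 0 := by
    exact_mod_cast (Real.sqrt_pos.2 hpos).ne'
  have hstar : star ((Real.sqrt A : ℝ) : ℂ) = ((Real.sqrt A : ℝ) : ℂ) := Complex.conj_ofReal _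
  generalize ((Real.sqrt A : ℝ) : ℂ) = c at hs hs0 hstar
  -- Here |a| = c and |b| = 1/c, so shifting the factor c normalises both vectors.
  refine ⟨c⁻¹ • a, c • star b, ?_, ?_, ?_⟩
  · rw [star_smul, smul_dotProduct, dotProduct_smul, hA, star_inv₀, hstar, ← hs]
    simp only [smul_eq_mul]
    field_simp
  · rw [star_smul, smul_dotProduct, dotProduct_smul, star_star, hstar]
    simp only [smul_eq_mul]
    rw [← mul_assoc, hs, hAB]
  · ext x y
    simp only [Matrix.vecMulVec_apply, star_smul, star_star, hstar, Pi.smul_apply, smul_eq_mul]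
    field_simp

end MatrixLemmas

/-! ## Regular partial isometries of `T_r`-algebras -/

/-- One nonzero coordinate `y` fixes the block: any other nonzero coordinate `x` makes the entry
`(x, y)` of ξ ξ* nonzero. -/
theorem exists_block_of_unit {κ R : Type} [Fintype κ] {bl : κ → R} {ξ : κ → ℂ}
    (hξ : star ξ ⬝ᵥ ξ = 1)
    (h : ∀ x y, Matrix.vecMulVec ξ (star ξ) x y ≠ 0 → bl x = bl y) :
    ∃ i, ∀ x, ξ x ≠ 0 → bl x = i := by
  have h0 : ξ ≠ 0 := by
    rintro rfl
    simp at hξ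
  obtain ⟨y, hy⟩ := Function.ne_iff.1 h0
  refine ⟨bl y, fun x hx => h x y ?_⟩
  rw [Matrix.vecMulVec_apply]
  exact mul_ne_zero hx (star_ne_zero.2 hy)

section Rep

variable {r : ℕ} {d : Fin r → ℕ+}

theorem le_of_full_ne_zero {n : ℕ} (v : Matrix (Fin n) (Fin n) (TAlg d))
    (x y : Fin n × Idx d) (h : full v x y ≠ 0) : x.2.1 ≤ y.2.1 := by
  by_contra hlt
  exact h ((v x.1 y.1).2 (not_le.1 hlt))

theorem exists_full_eq {n : ℕ} {M : Matrix (Fin n × Idx d) (Fin n × Idx d) ℂ}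
    (h : ∀ x y, M x y ≠ 0 → x.2.1 ≤ y.2.1) :
    ∃ v : Matrix (Fin n) (Fin n) (TAlg d), full v = M := by
  refine ⟨fun a b => ⟨fun i j => M (a, i) (b, j), fun i j hij => ?_⟩, rfl⟩
  by_contra h0
  exact absurd (h _ _ h0) (not_le.2 hij)

/-- Entries below the block diagonal vanish in `M_n(A)`, and self-adjointness reflects this above
it. -/
theorem block_eq_of_selfAdjoint {n : ℕ} {p : Matrix (Fin n) (Fin n) (TAlg d)}
    (hp : (full p)ᴴ = full p) (x y : Fin n × Idx d) (h : full p x y ≠ 0) : x.2.1 = y.2.1 := by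
  refine le_antisymm (le_of_full_ne_zero p x y h) (le_of_full_ne_zero p y x ?_)
  rw [← hp, Matrix.conjTranspose_apply]
  exact star_ne_zero.2 h

/-- The inverse of a block triangular matrix is block triangular, and here it is the adjoint.
Unitaries of `M_n(A)` are thus block diagonal, which is why `∼` cannot mix blocks. -/
theorem block_eq_of_unitary {n : ℕ} {z : Matrix (Fin n) (Fin n) (TAlg d)}
    (hz : full z ∈ Matrix.unitaryGroup (Fin n × Idx d) ℂ) (x y : Fin n × Idx d)
    (h : full z x y ≠ 0) : x.2.1 = y.2.1 := by
  have h1 : (full z).BlockTriangular fun x => x.2.1 := by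
    intro x y hxy
    by_contra h0
    exact absurd (le_of_full_ne_zero z x y h0) (not_le.2 hxy)
  have hinv : full z * star (full z) = 1 := Matrix.mem_unitaryGroup_iff.1 hz
  let _ : Invertible (full z) := invertibleOfRightInverse _ _ hinv
  have h2 := Matrix.blockTriangular_inv_of_blockTriangular h1
  rw [Matrix.inv_eq_right_inv hinv] at h2
  refine le_antisymm (le_of_full_ne_zero z x y h) (not_lt.1 fun hlt => h ?_)
  have h3 := h2 hlt
  rw [Matrix.star_eq_conjTranspose, Matrix.conjTranspose_apply] at h3
  exact star_eq_zero.1 h3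

variable {n : ℕ} {J : Type} [Fintype J] [DecidableEq J]

/-- `v = X Y*`, where `X` and `Y` are isometries whose `s`-th columns are supported in the blocks
`i` and `j`, respectively, where `e s = (i, j)`. -/
def IsRep (v : Matrix (Fin n) (Fin n) (TAlg d)) (e : J → Edge r) : Prop :=
  ∃ X Y : Matrix (Fin n × Idx d) J ℂ, Xᴴ * X = 1 ∧ Yᴴ * Y = 1 ∧
    (∀ x s, X x s ≠ 0 → x.2.1 = (e s).1.1) ∧ (∀ x s, Y x s ≠ 0 → x.2.1 = (e s).1.2) ∧
    full v = X * Yᴴ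

/-- The projections u u* = ξ ξ* and u* u = η η* lie in `M_n(A)`, hence are block diagonal, which
confines ξ and η to single blocks. A nonzero entry of u gives the order of the two blocks. -/
theorem IsPisom.exists_edge {u : Matrix (Fin n) (Fin n) (TAlg d)} (hu : IsPisom u)
    (h1 : (full u).rank = 1) :
    ∃ (ξ η : Fin n × Idx d → ℂ) (e : Edge r), star ξ ⬝ᵥ ξ = 1 ∧ star η ⬝ᵥ η = 1 ∧
      (∀ x, ξ x ≠ 0 → x.2.1 = e.1.1) ∧ (∀ x, η x ≠ 0 → x.2.1 = e.1.2) ∧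
      full u = Matrix.vecMulVec ξ (star η) := by
  obtain ⟨⟨p, hp, hp'⟩, ⟨q, hq, hq'⟩⟩ := hu
  obtain ⟨ξ, η, hξ, hη, h⟩ := exists_unit_vectors h1 (hp ▸ hp'.isIdempotentElem)
  have hη' : η ⬝ᵥ star η = 1 := by rw [dotProduct_comm, hη]
  have ep : full p = Matrix.vecMulVec η (star η) := by
    rw [hp, h, Matrix.conjTranspose_vecMulVec, Matrix.vecMulVec_mul_vecMulVec, hξ, star_star,
      one_smul]
  have eq : full q = Matrix.vecMulVec ξ (star ξ) := by
    rw [hq, h, Matrix.conjTranspose_vecMulVec, Matrix.vecMulVec_mul_vecMulVec, star_star, hη,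
      one_smul]
  obtain ⟨i, hi⟩ := exists_block_of_unit (bl := fun x : Fin n × Idx d => x.2.1) hξ fun x y hxy =>
    block_eq_of_selfAdjoint hq'.isSelfAdjoint x y (eq ▸ hxy)
  obtain ⟨j, hj⟩ := exists_block_of_unit (bl := fun x : Fin n × Idx d => x.2.1) hη fun x y hxy =>
    block_eq_of_selfAdjoint hp'.isSelfAdjoint x y (ep ▸ hxy)
  refine ⟨ξ, η, ⟨(i, j), ?_⟩, hξ, hη, hi, hj, h⟩
  have hξ0 : ξ ≠ 0 := by
    rintro rfl
    simp at hξ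
  have hη0 : η ≠ 0 := by
    rintro rfl
    simp at hη
  obtain ⟨x, hx⟩ := Function.ne_iff.1 hξ0
  obtain ⟨y, hy⟩ := Function.ne_iff.1 hη0
  change i ≤ j
  rw [← hi x hx, ← hj y hy]
  refine le_of_full_ne_zero u x y ?_
  rw [h, Matrix.vecMulVec_apply]
  exact mul_ne_zero hx (star_ne_zero.2 hy)

/-- The unit vectors of the rank one summands become the columns of X and Y, and orthogonality of
the summands makes these columns orthonormal. -/
theorem IsRegPisom.exists_isRep {v : Matrix (Fin n) (Fin n) (TAlg d)} (hv : IsRegPisom v) :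
    ∃ (k : ℕ) (e : Fin k → Edge r), IsRep v e := by
  obtain ⟨-, k, u, hu1, hu2, rfl⟩ := hv
  choose ξ η e hξ hη hξe hηe hu using fun i => (hu1 i).1.exists_edge (hu1 i).2
  have orth : ∀ (a b ξ η : Fin n × Idx d → ℂ), star ξ ⬝ᵥ ξ = 1 → star η ⬝ᵥ η = 1 →
      Matrix.vecMulVec ξ (star a) * Matrix.vecMulVec b (star η) = 0 → star a ⬝ᵥ b = 0 := by
    intro a b ξ η hξ hη h
    rw [Matrix.vecMulVec_mul_vecMulVec] at h
    have hξ0 : ξ ≠ 0 := by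
      rintro rfl
      simp at hξ
    have hη0 : η ≠ 0 := by
      rintro rfl
      simp at hη
    obtain ⟨x, hx⟩ := Function.ne_iff.1 hξ0
    obtain ⟨y, hy⟩ := Function.ne_iff.1 hη0
    have h2 := congrFun (congrFun h x) y
    simp only [Matrix.vecMulVec_apply, Pi.smul_apply, smul_eq_mul, Matrix.zero_apply] at h2
    have h3 := (mul_eq_zero.1 h2).resolve_left hx
    exact (mul_eq_zero.1 h3).resolve_right (star_ne_zero.2 hy)
  refine ⟨k, e, Matrix.of fun x s => ξ s x, Matrix.of fun x s => η s x, ?_, ?_, fun x s => hξe s x,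
    fun x s => hηe s x, ?_⟩
  · ext s t
    rw [Matrix.one_apply]
    change star (ξ s) ⬝ᵥ ξ t = _
    split_ifs with hst
    · rw [← hst, hξ]
    · refine orth _ _ _ _ (hη s) (hη t) ?_
      rw [← (hu2 s t hst).1, hu, hu, Matrix.conjTranspose_vecMulVec, star_star]
  · ext s t
    rw [Matrix.one_apply]
    change star (η s) ⬝ᵥ η t = _
    split_ifs with hst
    · rw [← hst, hη]
    · refine orth _ _ _ _ (hξ s) (hξ t) ?_
      rw [← (hu2 s t hst).2, hu, hu, Matrix.conjTranspose_vecMulVec, star_star]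
  · let F : Matrix (Fin n) (Fin n) (TAlg d) →+ Matrix (Fin n × Idx d) (Fin n × Idx d) ℂ :=
      { toFun := full, map_zero' := full_zero, map_add' := full_add }
    change F (∑ i, u i) = _
    rw [map_sum]
    ext x y
    rw [Matrix.sum_apply, Matrix.mul_apply]
    refine Finset.sum_congr rfl fun s _ => ?_
    change full (u s) x y = _
    rw [hu]
    rfl

theorem IsRep.isPisom {v : Matrix (Fin n) (Fin n) (TAlg d)} {e : J → Edge r} (h : IsRep v e) :
    IsPisom v ∧ (full v).rank = Fintype.card J := by
  obtain ⟨X, Y, hX, hY, hXe, hYe, hv⟩ := h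
  -- Each column of Z lies in a single block, so the projection Z Z* is block diagonal and belongs
  -- to `M_n(A)`.
  have key : ∀ (Z : Matrix (Fin n × Idx d) J ℂ) (f : J → Fin r), Zᴴ * Z = 1 →
      (∀ x s, Z x s ≠ 0 → x.2.1 = f s) →
      ∃ p : Matrix (Fin n) (Fin n) (TAlg d), full p = Z * Zᴴ ∧ IsStarProjection (full p) := by
    intro Z f hZ hf
    obtain ⟨p, hp⟩ := exists_full_eq (d := d) (M := Z * Zᴴ) fun x y hxy => by
      rw [Matrix.mul_apply] at hxy
      obtain ⟨s, -, hs⟩ := Finset.exists_ne_zero_of_sum_ne_zero hxy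
      rw [hf x s (left_ne_zero_of_mul hs),
        hf y s (star_ne_zero.1 (right_ne_zero_of_mul hs))]
    refine ⟨p, hp, ?_⟩
    rw [hp]
    refine ⟨?_, ?_⟩
    · rw [IsIdempotentElem, Matrix.mul_assoc, ← Matrix.mul_assoc Zᴴ, hZ, Matrix.one_mul]
    · rw [IsSelfAdjoint, Matrix.star_eq_conjTranspose, Matrix.conjTranspose_mul,
        Matrix.conjTranspose_conjTranspose]
  obtain ⟨p, hp, hp'⟩ := key Y _ hY hYe
  obtain ⟨q, hq, hq'⟩ := key X _ hX hXe
  have e1 : full p = (full v)ᴴ * full v := by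
    rw [hp, hv, Matrix.conjTranspose_mul, Matrix.conjTranspose_conjTranspose, Matrix.mul_assoc,
      ← Matrix.mul_assoc Xᴴ, hX, Matrix.one_mul]
  have e2 : full q = full v * (full v)ᴴ := by
    rw [hq, hv, Matrix.conjTranspose_mul, Matrix.conjTranspose_conjTranspose, Matrix.mul_assoc,
      ← Matrix.mul_assoc Yᴴ, hY, Matrix.one_mul]
  refine ⟨⟨⟨p, e1, hp'⟩, ⟨q, e2, hq'⟩⟩, le_antisymm ?_ ?_⟩
  · rw [hv]
    exact (Matrix.rank_mul_le_left _ _).trans (Matrix.rank_le_card_width _)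
  · have h1 : Xᴴ * full v * Y = 1 := by
      rw [hv, ← Matrix.mul_assoc, hX, Matrix.one_mul, hY]
    have h2 := (Matrix.rank_mul_le_left (Xᴴ * full v) Y).trans (Matrix.rank_mul_le_right _ _)
    rwa [h1, Matrix.rank_one] at h2

theorem IsRep.isRegPisom_of_unique [Unique J] {v : Matrix (Fin n) (Fin n) (TAlg d)}
    {e : J → Edge r} (h : IsRep v e) : IsRegPisom v := by
  obtain ⟨h1, h2⟩ := h.isPisom
  refine isRegPisom_of_decomposition h1 (J := Unit) (fun _ => v) (fun _ => ⟨h1, ?_⟩) ?_ (by simp)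
  · rw [h2, Fintype.card_unique]
  · exact fun i j hij => absurd (Subsingleton.elim i j) hij

theorem IsRep.reindex {K : Type} [Fintype K] [DecidableEq K] {v : Matrix (Fin n) (Fin n) (TAlg d)}
    {e : J → Edge r} (h : IsRep v e) (σ : K ≃ J) : IsRep v (e ∘ σ) := by
  obtain ⟨X, Y, hX, hY, hXe, hYe, hv⟩ := h
  refine ⟨X.submatrix id σ, Y.submatrix id σ, ?_, ?_, fun x s => hXe x _, fun x s => hYe x _, ?_⟩
  · rw [Matrix.conjTranspose_submatrix, ← Matrix.submatrix_mul _ _ _ _ _ Function.bijective_id, hX,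
      Matrix.submatrix_one_equiv]
  · rw [Matrix.conjTranspose_submatrix, ← Matrix.submatrix_mul _ _ _ _ _ Function.bijective_id, hY,
      Matrix.submatrix_one_equiv]
  · rw [Matrix.conjTranspose_submatrix, Matrix.submatrix_mul_equiv, hv, Matrix.submatrix_id_id]

theorem IsRep.dsum {m : ℕ} {K : Type} [Fintype K] [DecidableEq K]
    {v : Matrix (Fin n) (Fin n) (TAlg d)} {w : Matrix (Fin m) (Fin m) (TAlg d)}
    {e : J → Edge r} {e' : K → Edge r} (h : IsRep v e) (h' : IsRep w e') :
    IsRep (dsum v w) (Sum.elim e e') := by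
  obtain ⟨X, Y, hX, hY, hXe, hYe, hv⟩ := h
  obtain ⟨X', Y', hX', hY', hXe', hYe', hv'⟩ := h'
  have supp : ∀ (Z : Matrix (Fin n × Idx d) J ℂ) (Z' : Matrix (Fin m × Idx d) K ℂ)
      (f : J → Fin r) (f' : K → Fin r), (∀ x s, Z x s ≠ 0 → x.2.1 = f s) →
      (∀ x s, Z' x s ≠ 0 → x.2.1 = f' s) → ∀ (x : Fin (n + m) × Idx d) (s : J ⊕ K),
      (Matrix.fromBlocks Z 0 0 Z').submatrix ((Equiv.sumProdDistrib _ _ _).symm.trans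
        (finSumFinEquiv.prodCongr (Equiv.refl (Idx d)))).symm id x s ≠ 0 →
      x.2.1 = Sum.elim f f' s := by
    rintro Z Z' f f' hf hf' ⟨a, i⟩ s hs
    obtain ⟨a, rfl⟩ := finSumFinEquiv.surjective a
    simp only [Matrix.submatrix_apply, Equiv.symm_trans_apply, Equiv.symm_symm,
      Equiv.prodCongr_symm, Equiv.prodCongr_apply, Prod.map_apply, Equiv.refl_symm,
      Equiv.refl_apply, Equiv.symm_apply_apply, id] at hs
    rcases a with a | a <;> rcases s with s | s
    · exact hf (a, i) s (by simpa using hs)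
    · simp at hs
    · simp at hs
    · exact hf' (a, i) s (by simpa using hs)
  refine ⟨_, _, ?_, ?_, fun x s hs => (supp X X' _ _ hXe hXe' x s hs).trans ?_,
    fun x s hs => (supp Y Y' _ _ hYe hYe' x s hs).trans ?_, ?_⟩
  · rw [Matrix.conjTranspose_submatrix, Matrix.submatrix_mul_equiv,
      Matrix.fromBlocks_conjTranspose, Matrix.fromBlocks_multiply]
    simp [hX, hX']
  · rw [Matrix.conjTranspose_submatrix, Matrix.submatrix_mul_equiv,
      Matrix.fromBlocks_conjTranspose, Matrix.fromBlocks_multiply]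
    simp [hY, hY']
  · rcases s with s | s <;> rfl
  · rcases s with s | s <;> rfl
  · rw [full_dsum, hv, hv', Matrix.conjTranspose_submatrix,
      ← Matrix.submatrix_mul _ _ _ _ _ Function.bijective_id, Matrix.fromBlocks_conjTranspose,
      Matrix.fromBlocks_multiply]
    simp

theorem IsRep.pad {v : Matrix (Fin n) (Fin n) (TAlg d)} {e : J → Edge r} (h : IsRep v e)
    {N : ℕ} (hN : n ≤ N) : IsRep (pad N v) e := by
  obtain ⟨X, Y, hX, hY, hXe, hYe, hv⟩ := h
  let P : Matrix (Fin n × Idx d) J ℂ → Matrix (Fin N × Idx d) J ℂ := fun Z =>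
    Matrix.of fun x s => if h : (x.1 : ℕ) < n then Z (⟨x.1, h⟩, x.2) s else 0
  have hP : ∀ Z x s, P Z (Fin.castLE hN x.1, x.2) s = Z x s := fun Z x s => by simp [P]
  have hiso : ∀ Z, Zᴴ * Z = 1 → (P Z)ᴴ * P Z = 1 := by
    intro Z hZ
    rw [← hZ]
    ext s t
    rw [Matrix.mul_apply, Matrix.mul_apply]
    refine (Finset.sum_of_injOn (fun x : Fin n × Idx d => (Fin.castLE hN x.1, x.2)) ?_ ?_ ?_
      ?_).symm
    · rintro ⟨a, i⟩ - ⟨b, j⟩ - hab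
      simpa using hab
    · simp
    · rintro ⟨a, i⟩ - hx
      have ha : ¬ (a : ℕ) < n := fun ha => hx ⟨(⟨a, ha⟩, i), by simp, rfl⟩
      simp [P, ha]
    · rintro x -
      rw [Matrix.conjTranspose_apply, Matrix.conjTranspose_apply, hP, hP]
  have hsupp : ∀ Z (f : J → Fin r), (∀ x s, Z x s ≠ 0 → x.2.1 = f s) →
      ∀ x s, P Z x s ≠ 0 → x.2.1 = f s := by
    rintro Z f hf ⟨a, i⟩ s hs
    by_cases ha : (a : ℕ) < n
    · exact hf (⟨a, ha⟩, i) s (by simpa [P, ha] using hs)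
    · simp [P, ha] at hs
  refine ⟨P X, P Y, hiso X hX, hiso Y hY, hsupp X _ hXe, hsupp Y _ hYe, ?_⟩
  ext ⟨a, i⟩ ⟨b, j⟩
  by_cases ha : (a : ℕ) < n
  · by_cases hb : (b : ℕ) < n
    · have h := congrFun (congrFun hv (⟨a, ha⟩, i)) (⟨b, hb⟩, j)
      rw [Matrix.mul_apply] at h ⊢
      have h2 : full (DimDist.pad N v) (a, i) (b, j) = full v (⟨a, ha⟩, i) (⟨b, hb⟩, j) := by
        simp [full, DimDist.pad, ha, hb]
      rw [h2, h]
      simp [P, ha, hb]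
    · rw [Matrix.mul_apply]
      simp [P, full, DimDist.pad, hb]
  · rw [Matrix.mul_apply]
    simp [P, full, DimDist.pad, ha]

/-- Isometries with columns in the same blocks differ by block diagonal unitaries, which belong to
`M_N(A)`: from U X = X' and V Y = Y' follows U v V* = w. Thus the list of edges determines the
class. -/
theorem IsRep.equivalent {m : ℕ} {v : Matrix (Fin n) (Fin n) (TAlg d)}
    {w : Matrix (Fin m) (Fin m) (TAlg d)} {e : J → Edge r} (h : IsRep v e) (h' : IsRep w e) :
    Equivalent v w := by
  refine ⟨n + m, by omega, by omega, ?_⟩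
  obtain ⟨X, Y, hX, hY, hXe, hYe, hv⟩ := h.pad (show n ≤ n + m by omega)
  obtain ⟨X', Y', hX', hY', hXe', hYe', hw⟩ := h'.pad (show m ≤ n + m by omega)
  obtain ⟨U, hU, hUb, hUX⟩ := exists_block_unitary_mul_eq
    (bl := fun x : Fin (n + m) × Idx d => x.2.1) hX hX' hXe hXe'
  obtain ⟨V, hV, hVb, hVY⟩ := exists_block_unitary_mul_eq
    (bl := fun x : Fin (n + m) × Idx d => x.2.1) hY hY' hYe hYe'
  obtain ⟨z, rfl⟩ := exists_full_eq fun x y hxy => (hUb x y hxy).le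
  obtain ⟨y, hy⟩ := exists_full_eq (d := d) (M := star V) fun x y hxy =>
    (hVb y x (star_ne_zero.1 hxy)).ge
  refine ⟨z, y, hU, hy ▸ Unitary.star_mem hV, full_injective ?_⟩
  rw [full_mul, full_mul, hv, hw, hy, ← hUX, ← hVY, Matrix.conjTranspose_mul,
    Matrix.star_eq_conjTranspose]
  simp only [Matrix.mul_assoc]

end Rep

/-! ## The structure of `G(A)` for a `T_r`-algebra `A` -/

section Classes

variable {r : ℕ} {d : Fin r → ℕ+}

theorem clsPi_eq_of_equivalent {v w : PiReg (TAlg d)} (h : Equivalent v.2.1 w.2.1) :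
    clsPi v = clsPi w :=
  QuotientAddGroup.eq_iff_sub_mem.2 (AddSubgroup.subset_closure (Relation.equiv v w h))

theorem clsPi_dsum (v w : PiReg (TAlg d)) :
    clsPi ⟨v.1 + w.1, _, v.2.2.dsum w.2.2⟩ = clsPi v + clsPi w :=
  QuotientAddGroup.eq_iff_sub_mem.2 (AddSubgroup.subset_closure (Relation.dsum v w))

theorem G_hom_ext {M : Type} [AddCommGroup M] {F F' : G (TAlg d) →+ M}
    (h : ∀ v, F (clsPi v) = F' (clsPi v)) : F = F' :=
  QuotientAddGroup.addMonoidHom_ext _ (FreeAbelianGroup.lift_ext _ _ h)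

/-- A matrix unit of a `T_r`-algebra. -/
def mUnit (x y : Idx d) (h : x.1 ≤ y.1) : TAlg d :=
  ⟨Matrix.single x y 1, fun a b hab => by
    refine Matrix.single_apply_of_ne _ _ _ _ _ fun h' => ?_
    obtain ⟨rfl, rfl⟩ := h'
    exact absurd h (not_le.2 hab)⟩

/-- Elements of `A` which are sums `∑ ξ_s η_s*` of rank one matrices. -/
theorem isRep_one1 {J : Type} [Fintype J] [DecidableEq J] {v : TAlg d} {e : J → Edge r}
    {X Y : Matrix (Idx d) J ℂ} (hX : Xᴴ * X = 1) (hY : Yᴴ * Y = 1)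
    (hXe : ∀ x s, X x s ≠ 0 → x.1 = (e s).1.1) (hYe : ∀ x s, Y x s ≠ 0 → x.1 = (e s).1.2)
    (hv : (v : Matrix (Idx d) (Idx d) ℂ) = X * Yᴴ) : IsRep (one1 v) e := by
  let E : Idx d ≃ Fin 1 × Idx d := (Equiv.uniqueProd (Idx d) (Fin 1)).symm
  refine ⟨X.submatrix E.symm id, Y.submatrix E.symm id, ?_, ?_, fun x s => hXe _ s,
    fun x s => hYe _ s, ?_⟩
  · rw [Matrix.conjTranspose_submatrix, Matrix.submatrix_mul_equiv, hX, Matrix.submatrix_id_id]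
  · rw [Matrix.conjTranspose_submatrix, Matrix.submatrix_mul_equiv, hY, Matrix.submatrix_id_id]
  · rw [Matrix.conjTranspose_submatrix, ← Matrix.submatrix_mul _ _ _ _ _ Function.bijective_id,
      ← hv]
    rfl

theorem isRep_mUnit (x y : Idx d) (h : x.1 ≤ y.1) :
    IsRep (one1 (mUnit x y h)) fun _ : Fin 1 => ⟨(x.1, y.1), h⟩ := by
  refine isRep_one1 (X := Matrix.single x 0 1) (Y := Matrix.single y 0 1) ?_ ?_ ?_ ?_ ?_
  · ext i j
    obtain rfl := Subsingleton.elim i 0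
    obtain rfl := Subsingleton.elim j 0
    simp [Matrix.conjTranspose_single]
  · ext i j
    obtain rfl := Subsingleton.elim i 0
    obtain rfl := Subsingleton.elim j 0
    simp [Matrix.conjTranspose_single]
  · intro z s hz
    rw [Matrix.single_apply] at hz
    by_cases hxz : x = z
    · exact congrArg Sigma.fst hxz.symm
    · simp [hxz] at hz
  · intro z s hz
    rw [Matrix.single_apply] at hz
    by_cases hxz : y = z
    · exact congrArg Sigma.fst hxz.symm
    · simp [hxz] at hz
  · simp [mUnit, Matrix.conjTranspose_single]

theorem isRegPisom_mUnit (x y : Idx d) (h : x.1 ≤ y.1) : IsRegPisom (one1 (mUnit x y h)) :=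
  (isRep_mUnit x y h).isRegPisom_of_unique

variable (d) in
/-- The class of the matrix units of block `e`. -/
def edgeCls (e : Edge r) : G (TAlg d) :=
  cls (mUnit ⟨e.1.1, 0⟩ ⟨e.1.2, 0⟩ e.2) (isRegPisom_mUnit _ _ _)

/-- A model with prescribed edges, built by adjoining one matrix unit at a time, with which
`IsRep.clsPi_eq` compares an arbitrary partial isometry. -/
theorem exists_clsPi_eq_sum : ∀ (k : ℕ) (e : Fin k → Edge r),
    ∃ v : PiReg (TAlg d), IsRep v.2.1 e ∧ clsPi v = ∑ j, edgeCls d (e j)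
  | 0, e => by
    have h0 : IsRegPisom (0 : Matrix (Fin 0) (Fin 0) (TAlg d)) :=
      ⟨isPisom_zero, 0, Fin.elim0, fun i => i.elim0, fun i => i.elim0, by simp⟩
    refine ⟨⟨0, 0, h0⟩, ⟨0, 0, Subsingleton.elim _ _, Subsingleton.elim _ _, fun _ s => s.elim0,
      fun _ s => s.elim0, by simp [full_zero]⟩, ?_⟩
    -- [0] = [0 ⊕ 0] = [0] + [0] makes the class of the empty matrix vanish.
    have h := clsPi_dsum (⟨0, 0, h0⟩ : PiReg (TAlg d)) ⟨0, 0, h0⟩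
    have e0 : (⟨0 + 0, _, h0.dsum h0⟩ : PiReg (TAlg d)) = ⟨0, 0, h0⟩ :=
      Sigma.ext rfl (heq_of_eq (Subtype.ext (Matrix.ext fun i => Fin.elim0 i)))
    rw [Finset.univ_eq_empty, Finset.sum_empty]
    refine left_eq_add.1 (Eq.trans ?_ h)
    exact congrArg clsPi e0.symm
  | k + 1, e => by
    obtain ⟨v, hv, hc⟩ := exists_clsPi_eq_sum k fun i => e i.castSucc
    let w : PiReg (TAlg d) := ⟨1, one1 (mUnit ⟨(e (Fin.last k)).1.1, 0⟩ ⟨(e (Fin.last k)).1.2, 0⟩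
      (e (Fin.last k)).2), isRegPisom_mUnit _ _ _⟩
    refine ⟨⟨v.1 + w.1, _, v.2.2.dsum w.2.2⟩, ?_, ?_⟩
    · have h := (hv.dsum (isRep_mUnit (d := d) ⟨(e (Fin.last k)).1.1, 0⟩
        ⟨(e (Fin.last k)).1.2, 0⟩ (e (Fin.last k)).2)).reindex finSumFinEquiv.symm
      convert h using 1
      ext1 i
      refine Fin.lastCases ?_ (fun i => ?_) i
      · have : (finSumFinEquiv (m := k) (n := 1)).symm (Fin.last k) = Sum.inr 0 := by
          rw [Equiv.symm_apply_eq]; rfl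
        simp [this]
      · have : (finSumFinEquiv (m := k) (n := 1)).symm i.castSucc = Sum.inl i := by
          rw [Equiv.symm_apply_eq]; rfl
        simp [this]
    · rw [clsPi_dsum, hc, Fin.sum_univ_castSucc]
      rfl

/-- `v` is equivalent to the model with the same edges. In particular the edge classes generate
G(A). -/
theorem IsRep.clsPi_eq {J : Type} [Fintype J] [DecidableEq J] {v : PiReg (TAlg d)}
    {e : J → Edge r} (h : IsRep v.2.1 e) : clsPi v = ∑ j, edgeCls d (e j) := by
  let σ := (Fintype.equivFin J).symm
  obtain ⟨w, hw, hc⟩ := exists_clsPi_eq_sum (d := d) _ (e ∘ σ)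
  rw [clsPi_eq_of_equivalent ((h.reindex σ).equivalent hw), hc]
  exact Equiv.sum_comp σ fun j => edgeCls d (e j)

/-- A homomorphism on `G(A)` is determined by the classes of matrix units. -/
theorem G_hom_ext_edge {M : Type} [AddCommGroup M] {F F' : G (TAlg d) →+ M}
    (h : ∀ e, F (edgeCls d e) = F' (edgeCls d e)) : F = F' := by
  refine G_hom_ext fun v => ?_
  obtain ⟨k, e, he⟩ := v.2.2.exists_isRep
  rw [he.clsPi_eq, map_sum, map_sum]
  exact Finset.sum_congr rfl fun j _ => h _

/-! ### The multiplicity of an edge -/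

/-- The projection onto a block. -/
def blockProj {κ : Type} [DecidableEq κ] (bl : κ → Fin r) (i : Fin r) : Matrix κ κ ℂ :=
  Matrix.diagonal fun x => if bl x = i then 1 else 0

/-- Column `s` lies in block `f s`, so a block projection passes across X to the column index. -/
theorem blockProj_mul {κ J : Type} [Fintype κ] [DecidableEq κ] [Fintype J] [DecidableEq J]
    {bl : κ → Fin r} {f : J → Fin r} {X : Matrix κ J ℂ} (h : ∀ x s, X x s ≠ 0 → bl x = f s)
    (i : Fin r) : blockProj bl i * X = X * blockProj f i := by
  ext x s
  rw [blockProj, blockProj, Matrix.diagonal_mul, Matrix.mul_diagonal]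
  by_cases h0 : X x s = 0
  · simp [h0]
  · rw [h x s h0, mul_comm]

theorem blockProj_mul_conjTranspose {κ J : Type} [Fintype κ] [DecidableEq κ] [Fintype J]
    [DecidableEq J] {bl : κ → Fin r} {f : J → Fin r} {X : Matrix κ J ℂ}
    (h : ∀ x s, X x s ≠ 0 → bl x = f s) (i : Fin r) :
    blockProj f i * Xᴴ = Xᴴ * blockProj bl i :=
  (blockProj_mul (fun s x hs => (h x s (star_ne_zero.1 hs)).symm) i)

/-- For `v = ∑ ξ_s η_s*` this is the number of indices `s` such that `ξ_s` and `η_s` lie in the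
blocks `e.1.1` and `e.1.2`. -/
def edgeMult {n : ℕ} (e : Edge r) (v : Matrix (Fin n) (Fin n) (TAlg d)) : ℂ :=
  (blockProj (fun x : Fin n × Idx d => x.2.1) e.1.1 * full v *
    blockProj (fun x : Fin n × Idx d => x.2.1) e.1.2 * (full v)ᴴ).trace

/-- Moved across X and Y, the block projections become 0-1 diagonal matrices on `J`; then Y* Y = 1
and, under the trace, X* X = 1 remove the isometries. -/
theorem IsRep.edgeMult_eq {n : ℕ} {J : Type} [Fintype J] [DecidableEq J]
    {v : Matrix (Fin n) (Fin n) (TAlg d)} {e : J → Edge r} (h : IsRep v e) (ε : Edge r) :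
    edgeMult ε v = ∑ s, if e s = ε then 1 else 0 := by
  obtain ⟨X, Y, hX, hY, hXe, hYe, hv⟩ := h
  have h1 : blockProj (fun x : Fin n × Idx d => x.2.1) ε.1.1 * full v *
      blockProj (fun x : Fin n × Idx d => x.2.1) ε.1.2 * (full v)ᴴ =
      X * (blockProj (fun s => (e s).1.1) ε.1.1 * blockProj (fun s => (e s).1.2) ε.1.2 * Xᴴ) := by
    rw [hv, Matrix.conjTranspose_mul, Matrix.conjTranspose_conjTranspose,
      ← Matrix.mul_assoc _ X, blockProj_mul hXe]
    simp only [Matrix.mul_assoc]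
    rw [← Matrix.mul_assoc (blockProj _ _) Y, blockProj_mul hYe, Matrix.mul_assoc,
      ← Matrix.mul_assoc Yᴴ, hY, Matrix.one_mul]
  rw [edgeMult, h1, Matrix.trace_mul_comm, Matrix.mul_assoc, hX, Matrix.mul_one, blockProj,
    blockProj, Matrix.diagonal_mul_diagonal, Matrix.trace_diagonal]
  refine Finset.sum_congr rfl fun s _ => ?_
  simp only [Subtype.ext_iff, Prod.ext_iff]
  by_cases h2 : (e s).1.1 = ε.1.1 <;> by_cases h3 : (e s).1.2 = ε.1.2 <;> simp [h2, h3]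

/-- Unitaries of `M_N(A)` commute with the block projections; y then cancels against its adjoint
directly, and z under the trace. -/
theorem edgeMult_mul_unitary {N : ℕ} (ε : Edge r) {z v y : Matrix (Fin N) (Fin N) (TAlg d)}
    (hz : full z ∈ Matrix.unitaryGroup (Fin N × Idx d) ℂ)
    (hy : full y ∈ Matrix.unitaryGroup (Fin N × Idx d) ℂ) :
    edgeMult ε (z * v * y) = edgeMult ε v := by
  have h1 := blockProj_mul (block_eq_of_unitary hz) ε.1.1
  have h2 := blockProj_mul_conjTranspose (block_eq_of_unitary hz) ε.1.1
  have h3 := blockProj_mul (block_eq_of_unitary hy) ε.1.2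
  have hy' : full y * (full y)ᴴ = 1 := Matrix.mem_unitaryGroup_iff.1 hy
  have hz' : (full z)ᴴ * full z = 1 := Matrix.mem_unitaryGroup_iff'.1 hz
  rw [edgeMult, edgeMult, full_mul, full_mul, Matrix.conjTranspose_mul, Matrix.conjTranspose_mul]
  simp only [← Matrix.mul_assoc]
  rw [h1, Matrix.mul_assoc _ (full y), ← h3, ← Matrix.mul_assoc, Matrix.mul_assoc _ (full y), hy',
    Matrix.mul_one, Matrix.trace_mul_comm]
  simp only [← Matrix.mul_assoc]
  rw [hz', Matrix.one_mul]

/-- The homomorphism `G(A) → ℂ` which counts the multiplicity of an edge. -/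
def edgeCount (e : Edge r) : G (TAlg d) →+ ℂ :=
  QuotientAddGroup.lift _ (FreeAbelianGroup.lift fun v : PiReg (TAlg d) => edgeMult e v.2.1) (by
    rw [AddSubgroup.closure_le]
    intro x hx
    change FreeAbelianGroup.lift (fun v : PiReg (TAlg d) => edgeMult e v.2.1) x = 0
    rcases hx with ⟨v, w⟩ | ⟨v, w, h⟩
    · obtain ⟨k, f, hf⟩ := v.2.2.exists_isRep
      obtain ⟨l, g, hg⟩ := w.2.2.exists_isRep
      rw [map_sub, map_add, FreeAbelianGroup.lift_apply_of, FreeAbelianGroup.lift_apply_of,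
        FreeAbelianGroup.lift_apply_of, hf.edgeMult_eq, hg.edgeMult_eq, (hf.dsum hg).edgeMult_eq,
        Fintype.sum_sum_type]
      exact sub_self _
    · obtain ⟨k, f, hf⟩ := v.2.2.exists_isRep
      obtain ⟨l, g, hg⟩ := w.2.2.exists_isRep
      -- Padding keeps the list of edges, hence the multiplicity, so both sides can be compared in
      -- the common `M_N(A)`.
      obtain ⟨N, hn, hm, z, y, hz, hy, hzy⟩ := h
      rw [map_sub, FreeAbelianGroup.lift_apply_of, FreeAbelianGroup.lift_apply_of,
        hf.edgeMult_eq, hg.edgeMult_eq, ← (hf.pad hn).edgeMult_eq, ← (hg.pad hm).edgeMult_eq,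
        ← hzy, edgeMult_mul_unitary _ hz hy, sub_self])

theorem edgeCount_clsPi (e : Edge r) (v : PiReg (TAlg d)) :
    edgeCount e (clsPi v) = edgeMult e v.2.1 :=
  FreeAbelianGroup.lift_apply_of _ _

/-- The counts are dual to the edge classes, which are therefore independent. -/
theorem edgeCount_edgeCls (e e' : Edge r) :
    edgeCount e (edgeCls d e') = if e' = e then 1 else 0 := by
  rw [edgeCls, cls, edgeCount_clsPi, (isRep_mUnit _ _ _).edgeMult_eq]
  simp

/-- Elements of the scale have bounded multiplicities. -/
theorem edgeCount_le_of_mem_scale {g : G (TAlg d)} (hg : g ∈ scale (TAlg d)) (i : Fin r) :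
    ∃ c : ℕ, edgeCount ⟨(i, i), le_rfl⟩ g = c ∧ c ≤ d i := by
  obtain ⟨v, hv, rfl⟩ := hg
  obtain ⟨k, e, he⟩ := hv.exists_isRep
  refine ⟨(Finset.univ.filter fun s => e s = ⟨(i, i), le_rfl⟩).card, ?_, ?_⟩
  · rw [cls, edgeCount_clsPi, he.edgeMult_eq]
    simp
  -- Indices with edge (i, i) are among the columns of X lying in block i, and these are orthonormal
  -- in a space of dimension `d i`.
  · obtain ⟨X, -, hX, -, hXe, -, -⟩ := he
    have h := card_fiber_le (bl := fun x : Fin 1 × Idx d => x.2.1) hX hXe i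
    have h2 : Fintype.card {x : Fin 1 × Idx d // x.2.1 = i} = d i := by
      rw [← Fintype.card_fin (d i)]
      refine Fintype.card_congr ⟨fun x => x.2 ▸ x.1.2.2, fun a => ⟨(0, ⟨i, a⟩), rfl⟩, ?_, ?_⟩
      · rintro ⟨⟨a, j, b⟩, rfl⟩
        simp [Subsingleton.elim a 0]
      · intro a
        rfl
    rw [h2] at h
    refine le_trans ?_ h
    rw [Fintype.card_subtype]
    refine Finset.card_le_card fun s hs => ?_
    simp only [Finset.mem_filter, Finset.mem_univ, true_and] at hs ⊢
    rw [hs]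

/-- The class of the identity. -/
theorem sum_edgeCls_mem_scale :
    ∑ x : Idx d, edgeCls d ⟨(x.1, x.1), le_rfl⟩ ∈ scale (TAlg d) := by
  have h : IsRep (one1 (1 : TAlg d)) fun x : Idx d => (⟨(x.1, x.1), le_rfl⟩ : Edge r) := by
    refine isRep_one1 (X := 1) (Y := 1) (by simp) (by simp) ?_ ?_ (by simp) <;>
    · intro x y hxy
      rw [Matrix.one_apply] at hxy
      by_cases hne : x = y
      · rw [hne]
      · simp [hne] at hxy
  have hreg : IsRegPisom (one1 (1 : TAlg d)) := by
    refine isRegPisom_of_decomposition h.isPisom.1 (fun x : Idx d => one1 (mUnit x x le_rfl))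
      (fun x => ?_) (fun x y hxy => ?_) ?_
    · have := (isRep_mUnit x x le_rfl).isPisom
      simpa using this
    · have h3 : ∀ z : Idx d, full (one1 (mUnit z z le_rfl)) =
          Matrix.single ((0 : Fin 1), z) ((0 : Fin 1), z) (1 : ℂ) := by
        intro z
        ext ⟨a, i⟩ ⟨b, j⟩
        simp [full, one1, mUnit, Matrix.single_apply, Subsingleton.elim a 0,
          Subsingleton.elim b 0]
      rw [h3, h3]
      simp [Matrix.conjTranspose_single, hxy]
    · ext a b : 1
      rw [Matrix.sum_apply]
      refine Subtype.ext ?_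
      simp only [one1, mUnit, AddSubmonoidClass.coe_finsetSum]
      exact (Matrix.sum_single_one).symm
  exact ⟨1, hreg, (IsRep.clsPi_eq (v := ⟨1, _, hreg⟩) h).symm⟩

end Classes

/-! ## The structure of regular homomorphisms -/

section RegularHoms

set_option linter.unusedSectionVars false

variable {ι κ μ : Type} [Fintype ι] [DecidableEq ι] [Fintype κ] [DecidableEq κ]
  [Fintype μ] [DecidableEq μ]

theorem isRegular_of_fintype {A : Subalgebra ℂ (Matrix ι ι ℂ)} {B : Subalgebra ℂ (Matrix κ κ ℂ)}
    {α : A →ₙₐ[ℂ] B} {S : Type} [Fintype S] (θ : S → (A →ₙₐ[ℂ] B)) (h1 : ∀ i, MultOne (θ i))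
    (h2 : ∀ i j, i ≠ j → ∀ a b : A, θ i a * θ j b = 0) (h3 : ∀ a : A, α a = ∑ i, θ i a) :
    IsRegular α := by
  let e := (Fintype.equivFin S).symm
  refine ⟨Fintype.card S, θ ∘ e, fun i => h1 _, fun i j hij => h2 _ _ ?_, fun a => ?_⟩
  · exact fun h => hij (e.injective h)
  · rw [h3]
    exact (Equiv.sum_comp e fun i => θ i a).symm

theorem isRegStar_id (A : Subalgebra ℂ (Matrix ι ι ℂ)) :
    IsRegStar (NonUnitalAlgHom.id ℂ A) := by
  refine ⟨⟨NonUnitalStarAlgHom.id ℂ _, fun a => rfl⟩, ?_⟩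
  refine isRegular_of_fintype (S := Unit) (fun _ => NonUnitalAlgHom.id ℂ A)
    (fun _ => ⟨NonUnitalStarAlgHom.id ℂ _, fun a => rfl, fun p _ h => h⟩) ?_ (by simp)
  exact fun i j hij => absurd (Subsingleton.elim i j) hij

theorem IsRegStar.comp {A : Subalgebra ℂ (Matrix ι ι ℂ)} {B : Subalgebra ℂ (Matrix κ κ ℂ)}
    {C : Subalgebra ℂ (Matrix μ μ ℂ)} {β : B →ₙₐ[ℂ] C} {α : A →ₙₐ[ℂ] B} (hβ : IsRegStar β)
    (hα : IsRegStar α) : IsRegStar (β.comp α) := by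
  constructor
  · obtain ⟨b, hb⟩ := hβ.starExtendible
    obtain ⟨a, ha⟩ := hα.starExtendible
    exact ⟨b.comp a, fun x => (congrArg b (ha x)).trans (hb _)⟩
  · obtain ⟨k, θ, h1, h2, h3⟩ := hβ.regular
    obtain ⟨l, η, g1, g2, g3⟩ := hα.regular
    refine isRegular_of_fintype (S := Fin k × Fin l) (fun s => (θ s.1).comp (η s.2)) ?_ ?_ ?_
    · rintro ⟨s, t⟩
      obtain ⟨b, hb, hb'⟩ := h1 s
      obtain ⟨a, ha, ha'⟩ := g1 t
      exact ⟨b.comp a, fun x => (congrArg b (ha x)).trans (hb _), fun p hp hr =>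
        hb' _ (hp.map a) (ha' p hp hr)⟩
    · rintro ⟨s, t⟩ ⟨s', t'⟩ hne x y
      by_cases hs : s = s'
      · subst hs
        have ht : t ≠ t' := fun h => hne (by rw [h])
        simp only [NonUnitalAlgHom.comp_apply, ← map_mul, g2 t t' ht, map_zero]
      · exact h2 s s' hs _ _
    · intro a
      simp only [NonUnitalAlgHom.comp_apply, h3, g3, map_sum, Fintype.sum_prod_type]

/-- The orthogonal sum of the maps `X ↦ W_s X W_s*`. -/
def sumConj {S : Type} [Fintype S] [DecidableEq S] (W : S → Matrix κ ι ℂ)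
    (hW : ∀ s t, (W s)ᴴ * W t = if s = t then 1 else 0) :
    Matrix ι ι ℂ →⋆ₙₐ[ℂ] Matrix κ κ ℂ where
  toFun X := ∑ s, W s * X * (W s)ᴴ
  map_smul' c X := by simp [Finset.smul_sum]
  map_zero' := by simp
  map_add' X Y := by simp [Matrix.mul_add, Matrix.add_mul, Finset.sum_add_distrib]
  map_mul' X Y := by
    rw [Finset.sum_mul]
    refine Finset.sum_congr rfl fun s _ => ?_
    rw [Finset.mul_sum, Finset.sum_eq_single s]
    · simp only [Matrix.mul_assoc]
      rw [← Matrix.mul_assoc (W s)ᴴ, hW, if_pos rfl, Matrix.one_mul]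
    · intro t _ hts
      simp only [Matrix.mul_assoc]
      rw [← Matrix.mul_assoc (W s)ᴴ, hW, if_neg (Ne.symm hts)]
      simp
    · simp
  map_star' X := by
    simp only [Matrix.star_eq_conjTranspose, Matrix.conjTranspose_sum, Matrix.conjTranspose_mul,
      Matrix.conjTranspose_conjTranspose, Matrix.mul_assoc]

/-- The restriction of a C*-homomorphism. -/
def restrictHom {A : Subalgebra ℂ (Matrix ι ι ℂ)} {B : Subalgebra ℂ (Matrix κ κ ℂ)}
    (β : Matrix ι ι ℂ →⋆ₙₐ[ℂ] Matrix κ κ ℂ) (h : ∀ a ∈ A, β a ∈ B) : A →ₙₐ[ℂ] B where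
  toFun a := ⟨β a, h a a.2⟩
  map_smul' c a := Subtype.ext (map_smul β c (a : Matrix ι ι ℂ))
  map_zero' := Subtype.ext (map_zero β)
  map_add' a b := Subtype.ext (map_add β (a : Matrix ι ι ℂ) b)
  map_mul' a b := Subtype.ext (map_mul β (a : Matrix ι ι ℂ) b)

theorem rank_conj_isometry {W : Matrix κ ι ℂ} (hW : Wᴴ * W = 1) (X : Matrix ι ι ℂ) :
    (W * X * Wᴴ).rank = X.rank := by
  refine le_antisymm ((Matrix.rank_mul_le_left _ _).trans (Matrix.rank_mul_le_right _ _)) ?_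
  have h : X = Wᴴ * (W * X * Wᴴ) * W := by
    simp only [Matrix.mul_assoc, hW, Matrix.mul_one]
    rw [← Matrix.mul_assoc, hW, Matrix.one_mul]
  calc X.rank = (Wᴴ * (W * X * Wᴴ) * W).rank := by rw [← h]
    _ ≤ _ := (Matrix.rank_mul_le_left _ _).trans (Matrix.rank_mul_le_right _ _)

/-- A C*-homomorphism of multiplicity one is implemented by an isometry. -/
theorem exists_isometry_of_rank_one (x₀ : ι) (β : Matrix ι ι ℂ →⋆ₙₐ[ℂ] Matrix κ κ ℂ)
    (hβ : ∀ p : Matrix ι ι ℂ, IsStarProjection p → p.rank = 1 → (β p).rank = 1) :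
    ∃ W : Matrix κ ι ℂ, Wᴴ * W = 1 ∧ ∀ X, β X = W * X * Wᴴ := by
  have hp : IsStarProjection (Matrix.single x₀ x₀ (1 : ℂ)) :=
    ⟨by simp [IsIdempotentElem], by simp [IsSelfAdjoint, Matrix.star_eq_conjTranspose]⟩
  have hr : (Matrix.single x₀ x₀ (1 : ℂ)).rank = 1 := by
    have := rank_eq_trace hp.isIdempotentElem
    rw [Matrix.trace_single_eq_same] at this
    exact_mod_cast this
  have hq := hp.map β
  have hq1 : β (Matrix.single x₀ x₀ 1) * β (Matrix.single x₀ x₀ 1) = β (Matrix.single x₀ x₀ 1) :=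
    hq.isIdempotentElem
  have hq2 : (β (Matrix.single x₀ x₀ 1))ᴴ = β (Matrix.single x₀ x₀ 1) := hq.isSelfAdjoint
  obtain ⟨ξ, η, hξ, hη, hu⟩ := exists_unit_vectors (hβ _ hp hr)
    (by rw [hq2, hq1]; exact hq.isIdempotentElem)
  -- A projection p equals p p*, which turns ξ η* into ξ ξ*.
  have hpξ : β (Matrix.single x₀ x₀ 1) = Matrix.vecMulVec ξ (star ξ) := by
    have h : β (Matrix.single x₀ x₀ 1) =
        β (Matrix.single x₀ x₀ 1) * (β (Matrix.single x₀ x₀ 1))ᴴ := by rw [hq2, hq1]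
    rw [h, hu, Matrix.conjTranspose_vecMulVec, Matrix.vecMulVec_mul_vecMulVec, star_star, hη,
      one_smul]
  -- Transporting ξ by the images of the matrix units gives the columns of W; the matrix unit
  -- relations make them orthonormal, and β(e_xy) = w_x w_y*.
  let w : ι → κ → ℂ := fun x => β (Matrix.single x x₀ 1) *ᵥ ξ
  have hstar : ∀ x y, β (Matrix.single x y 1) = (β (Matrix.single y x 1))ᴴ := fun x y => by
    rw [← Matrix.star_eq_conjTranspose, ← map_star, Matrix.star_eq_conjTranspose,
      Matrix.conjTranspose_single, star_one]
  have hw : ∀ x y, β (Matrix.single x y 1) = Matrix.vecMulVec (w x) (star (w y)) := by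
    intro x y
    have h : Matrix.single x y (1 : ℂ) =
        Matrix.single x x₀ 1 * Matrix.single x₀ x₀ 1 * Matrix.single x₀ y 1 := by simp
    rw [h, map_mul, map_mul, hpξ, Matrix.mul_vecMulVec, Matrix.vecMulVec_mul, hstar x₀ y,
      ← Matrix.star_mulVec]
  have hww : ∀ x y, star (w x) ⬝ᵥ w y = if x = y then 1 else 0 := by
    intro x y
    rw [Matrix.star_mulVec, ← hstar, ← Matrix.dotProduct_mulVec, Matrix.mulVec_mulVec, ← map_mul]
    split_ifs with h
    · subst h
      rw [Matrix.single_mul_single_same, mul_one, hpξ, Matrix.vecMulVec_mulVec, hξ]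
      simp [hξ]
    · rw [Matrix.single_mul_single_of_ne (h := h), map_zero, Matrix.zero_mulVec, dotProduct_zero]
  refine ⟨Matrix.of fun k x => w x k, ?_, fun X => ?_⟩
  · ext x y
    rw [Matrix.one_apply]
    exact hww x y
  · have hX : X = ∑ i, ∑ j, X i j • Matrix.single i j (1 : ℂ) := by
      conv_lhs => rw [Matrix.matrix_eq_sum_single X]
      simp [Matrix.smul_single]
    conv_lhs => rw [hX]
    simp only [map_sum, map_smul, hw]
    ext a b
    simp only [Matrix.sum_apply, Matrix.smul_apply, Matrix.vecMulVec_apply, Matrix.mul_apply,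
      Finset.sum_mul, smul_eq_mul, Matrix.of_apply, Matrix.conjTranspose_apply, Pi.star_apply]
    rw [Finset.sum_comm]
    refine Finset.sum_congr rfl fun i _ => Finset.sum_congr rfl fun j _ => ?_
    ring

variable {r : ℕ} {d d' : Fin r → ℕ+}

theorem le_of_mem_TAlg {M : Matrix (Idx d) (Idx d) ℂ} (h : M ∈ TAlg d) {x y : Idx d}
    (hxy : M x y ≠ 0) : x.1 ≤ y.1 :=
  not_lt.1 fun hlt => hxy (h hlt)

/-- The image of e_xx is w_x w_x*, self-adjoint in the triangular target, so each column w_x of W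
sits in one block. The image w_x w_y* of e_xy, for x in a block not after that of y, orders the
blocks of w_x and w_y, which gives monotonicity. -/
theorem exists_isometry_of_multOne [NeZero r] {α : TAlg d →ₙₐ[ℂ] TAlg d'} (hα : MultOne α) :
    ∃ (W : Matrix (Idx d') (Idx d) ℂ) (π : Fin r → Fin r), Monotone π ∧ Wᴴ * W = 1 ∧
      (∀ x y, W x y ≠ 0 → x.1 = π y.1) ∧
      ∀ a : TAlg d, (α a : Matrix (Idx d') (Idx d') ℂ) = W * a.1 * Wᴴ := by
  obtain ⟨β, hβ, hβ'⟩ := hα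
  obtain ⟨W, hW, hβW⟩ := exists_isometry_of_rank_one (⟨0, 0⟩ : Idx d) β hβ'
  have hcol : ∀ x y, star (fun k => W k x) ⬝ᵥ (fun k => W k y) = if x = y then 1 else 0 :=
    fun x y => (congrFun (congrFun hW x) y).trans (Matrix.one_apply)
  have hunit : ∀ x y (h : x.1 ≤ y.1) k l,
      (α (mUnit x y h) : Matrix (Idx d') (Idx d') ℂ) k l = W k x * star (W l y) := by
    intro x y h k l
    rw [← hβ, hβW, mUnit, Matrix.mul_assoc, Matrix.mul_apply, Finset.sum_eq_single x]
    · rw [Matrix.single_mul_apply_same, one_mul, Matrix.conjTranspose_apply]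
    · intro z _ hz
      rw [Matrix.single_mul_apply_of_ne (h := hz), mul_zero]
    · simp
  have hne : ∀ x, ∃ k, W k x ≠ 0 := by
    intro x
    by_contra! h
    have h1 := hcol x x
    simp [dotProduct, h] at h1
  have hblock : ∀ x, ∃ i, ∀ k, W k x ≠ 0 → k.1 = i := by
    intro x
    refine exists_block_of_unit (bl := fun k : Idx d' => k.1) (ξ := fun k => W k x)
      ((hcol x x).trans (if_pos rfl)) fun k l hkl => ?_
    have h1 : W k x * star (W l x) ≠ 0 := hkl
    refine le_antisymm (le_of_mem_TAlg (α (mUnit x x le_rfl)).2 ?_)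
      (le_of_mem_TAlg (α (mUnit x x le_rfl)).2 ?_)
    · rwa [hunit]
    · rw [hunit]
      exact mul_ne_zero (star_ne_zero.1 (right_ne_zero_of_mul h1))
        (star_ne_zero.2 (left_ne_zero_of_mul h1))
  choose g hg using hblock
  have hmono : ∀ x y : Idx d, x.1 ≤ y.1 → g x ≤ g y := by
    intro x y hxy
    obtain ⟨k, hk⟩ := hne x
    obtain ⟨l, hl⟩ := hne y
    rw [← hg x k hk, ← hg y l hl]
    refine le_of_mem_TAlg (α (mUnit x y hxy)).2 ?_
    rw [hunit]
    exact mul_ne_zero hk (star_ne_zero.2 hl)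
  -- Coordinate 0 represents its block; inside a block the inequality `hmono` holds both ways, so
  -- the choice is immaterial.
  refine ⟨W, fun i => g ⟨i, 0⟩, fun i j hij => hmono _ _ hij, hW, fun x y hxy => ?_, fun a => ?_⟩
  · rw [hg y x hxy]
    exact le_antisymm (hmono _ _ le_rfl) (hmono _ _ le_rfl)
  · rw [← hβ, hβW]

/-- `α` is the orthogonal sum of the maps `a ↦ W_s a W_s*`, where the isometry `W_s` maps the
`i`-th block into the block `π s i`. -/
structure IsHomRep (α : TAlg d →ₙₐ[ℂ] TAlg d') {S : Type} [Fintype S] [DecidableEq S]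
    (π : S → Fin r → Fin r) (W : S → Matrix (Idx d') (Idx d) ℂ) : Prop where
  mono : ∀ s, Monotone (π s)
  iso : ∀ s t, (W s)ᴴ * W t = if s = t then 1 else 0
  supp : ∀ s x y, W s x y ≠ 0 → x.1 = π s y.1
  eq : ∀ a : TAlg d, (α a : Matrix (Idx d') (Idx d') ℂ) = ∑ s, W s * a.1 * (W s)ᴴ

/-- Orthogonality of the summands at the identity reads W_s W_s* W_t W_t* = 0, and compressing by
W_s* and W_t gives W_s* W_t = 0. -/
theorem IsRegStar.exists_isHomRep [NeZero r] {α : TAlg d →ₙₐ[ℂ] TAlg d'} (hα : IsRegStar α) :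
    ∃ (k : ℕ) (π : Fin k → Fin r → Fin r) (W : Fin k → Matrix (Idx d') (Idx d) ℂ),
      IsHomRep α π W := by
  obtain ⟨k, θ, h1, h2, h3⟩ := hα.regular
  choose W π hπ hW hs hθ using fun s => exists_isometry_of_multOne (h1 s)
  refine ⟨k, π, W, hπ, fun s t => ?_, hs, fun a => ?_⟩
  · split_ifs with hst
    · rw [← hst, hW]
    · have h := congrArg Subtype.val (h2 s t hst 1 1)
      change (θ s 1 : Matrix (Idx d') (Idx d') ℂ) * (θ t 1 : Matrix (Idx d') (Idx d') ℂ) = 0 at h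
      rw [hθ, hθ, OneMemClass.coe_one, Matrix.mul_one, Matrix.mul_one] at h
      have e : (W s)ᴴ * W t = (W s)ᴴ * (W s * (W s)ᴴ * (W t * (W t)ᴴ)) * W t := by
        simp only [Matrix.mul_assoc, hW, Matrix.mul_one]
        rw [← Matrix.mul_assoc (W s)ᴴ (W s), hW, Matrix.one_mul]
      rw [e, h, Matrix.mul_zero, Matrix.zero_mul]
  · rw [h3, AddSubmonoidClass.coe_finsetSum]
    exact Finset.sum_congr rfl fun s _ => hθ s a

/-- An entry of a joining block i to block j needs i ≤ j and is moved to the blocks π i ≤ π j. -/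
theorem conj_mem_TAlg {W : Matrix (Idx d') (Idx d) ℂ} {π : Fin r → Fin r} (hπ : Monotone π)
    (hs : ∀ x y, W x y ≠ 0 → x.1 = π y.1) {a : Matrix (Idx d) (Idx d) ℂ} (ha : a ∈ TAlg d) :
    W * a * Wᴴ ∈ TAlg d' := by
  intro x y hxy
  by_contra h
  rw [Matrix.mul_apply] at h
  obtain ⟨l, -, hl⟩ := Finset.exists_ne_zero_of_sum_ne_zero h
  have h1 := left_ne_zero_of_mul hl
  rw [Matrix.mul_apply] at h1
  obtain ⟨k, -, hk⟩ := Finset.exists_ne_zero_of_sum_ne_zero h1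
  have h2 := hs x k (left_ne_zero_of_mul hk)
  have h3 := hs y l (star_ne_zero.1 (right_ne_zero_of_mul hl))
  have h4 := hπ (le_of_mem_TAlg ha (right_ne_zero_of_mul hk))
  rw [← h2, ← h3] at h4
  exact absurd h4 (not_le.2 hxy)

theorem exists_hom_of_isometries {S : Type} [Fintype S] [DecidableEq S] {π : S → Fin r → Fin r}
    {W : S → Matrix (Idx d') (Idx d) ℂ} (hπ : ∀ s, Monotone (π s))
    (hW : ∀ s t, (W s)ᴴ * W t = if s = t then 1 else 0)
    (hs : ∀ s x y, W s x y ≠ 0 → x.1 = π s y.1) :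
    ∃ α : TAlg d →ₙₐ[ℂ] TAlg d', IsRegStar α ∧ IsHomRep α π W := by
  have hW1 : ∀ s, (W s)ᴴ * W s = 1 := fun s => (hW s s).trans (if_pos rfl)
  -- `sumConj` over a one-point index set provides the C*-extension of a single summand.
  have hone : ∀ (s : S) (i j : Unit), (W s)ᴴ * W s = if i = j then 1 else 0 := fun s i j => by
    rw [hW1, if_pos rfl]
  have hsum : ∀ (s : S) (X : Matrix (Idx d) (Idx d) ℂ),
      sumConj (fun _ : Unit => W s) (hone s) X = W s * X * (W s)ᴴ := fun s X => by
    change ∑ _ : Unit, W s * X * (W s)ᴴ = _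
    simp
  let θ : S → (TAlg d →ₙₐ[ℂ] TAlg d') := fun s =>
    restrictHom (sumConj (fun _ : Unit => W s) (hone s)) fun a ha => by
      rw [hsum]
      exact conj_mem_TAlg (hπ s) (hs s) ha
  have hθ : ∀ s a, (θ s a : Matrix (Idx d') (Idx d') ℂ) = W s * a.1 * (W s)ᴴ := fun s a => hsum s a
  let α : TAlg d →ₙₐ[ℂ] TAlg d' := restrictHom (sumConj W hW) fun a ha =>
    sum_mem fun s _ => conj_mem_TAlg (hπ s) (hs s) ha
  have hα : ∀ a, (α a : Matrix (Idx d') (Idx d') ℂ) = ∑ s, W s * a.1 * (W s)ᴴ := fun a => rfl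
  refine ⟨α, ⟨⟨sumConj W hW, fun a => rfl⟩, isRegular_of_fintype θ (fun s => ?_) ?_ ?_⟩,
    hπ, hW, hs, hα⟩
  · refine ⟨sumConj (fun _ : Unit => W s) (hone s), fun a => rfl, fun p _ hp => ?_⟩
    rw [hsum, rank_conj_isometry (hW1 s), hp]
  · intro s t hst a b
    refine Subtype.ext ?_
    change (θ s a : Matrix (Idx d') (Idx d') ℂ) * (θ t b : Matrix (Idx d') (Idx d') ℂ) = 0
    rw [hθ, hθ, Matrix.mul_assoc, Matrix.mul_assoc, ← Matrix.mul_assoc (W s)ᴴ,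
      ← Matrix.mul_assoc (W s)ᴴ, hW, if_neg hst]
    simp
  · intro a
    refine Subtype.ext ?_
    rw [hα, AddSubmonoidClass.coe_finsetSum]
    exact Finset.sum_congr rfl fun s _ => (hθ s a).symm

/-- The action of a monotone map on edges. -/
def edgeMap (p : Fin r → Fin r) (hp : Monotone p) (e : Edge r) : Edge r :=
  ⟨(p e.1.1, p e.1.2), hp e.2⟩

/-- The image of a matrix unit e_xy is the sum of (W_s e_x)(W_s e_y)*, with orthonormal vectors W_s
e_x for fixed x. Only the maps `π s` enter, not the block sizes `d`; this lets `exists_lift` change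
the domain. -/
theorem IsHomRep.Gmap_edgeCls {α : TAlg d →ₙₐ[ℂ] TAlg d'} {S : Type} [Fintype S] [DecidableEq S]
    {π : S → Fin r → Fin r} {W : S → Matrix (Idx d') (Idx d) ℂ} (h : IsHomRep α π W)
    (hα : IsRegStar α) (e : Edge r) :
    Gmap α hα (edgeCls d e) = ∑ s, edgeCls d' (edgeMap (π s) (h.mono s) e) := by
  rw [edgeCls, cls, Gmap_clsPi]
  refine IsRep.clsPi_eq (v := PiReg.map α hα ⟨1, _, isRegPisom_mUnit _ _ e.2⟩)
    (e := fun s => edgeMap (π s) (h.mono s) e) ?_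
  have hiso : ∀ x, (Matrix.of fun k s => W s k x : Matrix (Idx d') S ℂ)ᴴ *
      (Matrix.of fun k s => W s k x : Matrix (Idx d') S ℂ) = 1 := by
    intro x
    ext s t
    rw [Matrix.one_apply]
    refine (congrFun (congrFun (h.iso s t) x) x).trans ?_
    split_ifs <;> simp
  change IsRep (one1 (α (mUnit _ _ e.2))) _
  refine isRep_one1 (e := fun s => edgeMap (π s) (h.mono s) e)
    (X := Matrix.of fun k s => W s k ⟨e.1.1, 0⟩)
    (Y := Matrix.of fun k s => W s k ⟨e.1.2, 0⟩) (hiso _) (hiso _) (fun k s => h.supp s k _)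
    (fun k s => h.supp s k _) ?_
  rw [h.eq]
  ext k l
  rw [Matrix.sum_apply, Matrix.mul_apply]
  refine Finset.sum_congr rfl fun s _ => ?_
  rw [mUnit, Matrix.mul_assoc, Matrix.mul_apply, Finset.sum_eq_single ⟨e.1.1, 0⟩]
  · rw [Matrix.single_mul_apply_same, one_mul]
    rfl
  · intro z _ hz
    rw [Matrix.single_mul_apply_of_ne (h := hz), mul_zero]
  · simp

/-- Regular homomorphisms with the same multiplicities differ by a block diagonal unitary. -/
theorem IsHomRep.exists_unitary {α α' : TAlg d →ₙₐ[ℂ] TAlg d'} {S S' : Type} [Fintype S]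
    [DecidableEq S] [Fintype S'] [DecidableEq S'] {π : S → Fin r → Fin r}
    {W : S → Matrix (Idx d') (Idx d) ℂ} {π' : S' → Fin r → Fin r}
    {W' : S' → Matrix (Idx d') (Idx d) ℂ} (h : IsHomRep α π W) (h' : IsHomRep α' π' W')
    (σ : S ≃ S') (hσ : ∀ s, π' (σ s) = π s) :
    ∃ U ∈ Matrix.unitaryGroup (Idx d') ℂ, (∀ x y, U x y ≠ 0 → x.1 = y.1) ∧
      ∀ a, (α' a : Matrix (Idx d') (Idx d') ℂ) = U * α a * Uᴴ := by
  -- Side by side, the W_s form one isometry with columns indexed by `S × Idx d`, so a single block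
  -- unitary serves all summands at once.
  have hiso : ∀ V : S → Matrix (Idx d') (Idx d) ℂ,
      (∀ s t, (V s)ᴴ * V t = if s = t then 1 else 0) →
      (Matrix.of fun k p => V p.1 k p.2 : Matrix (Idx d') (S × Idx d) ℂ)ᴴ *
        (Matrix.of fun k p => V p.1 k p.2 : Matrix (Idx d') (S × Idx d) ℂ) = 1 := by
    rintro V hV
    ext ⟨s, x⟩ ⟨t, y⟩
    refine (congrFun (congrFun (hV s t) x) y).trans ?_
    by_cases hst : s = t <;> simp [hst, Matrix.one_apply]
  obtain ⟨U, hU, hUb, hUW⟩ := exists_block_unitary_mul_eq (bl := fun x : Idx d' => x.1)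
    (f := fun p : S × Idx d => π p.1 p.2.1) (hiso W h.iso)
    (hiso (fun s => W' (σ s)) fun s t => by
      rw [h'.iso]
      simp)
    (fun k p => h.supp p.1 k p.2) fun k p hk => by
      rw [h'.supp (σ p.1) k p.2 hk, hσ]
  have hUW' : ∀ s, U * W s = W' (σ s) := by
    intro s
    ext k x
    exact congrFun (congrFun hUW k) (s, x)
  refine ⟨U, hU, hUb, fun a => ?_⟩
  rw [h.eq, h'.eq, ← Equiv.sum_comp σ, Finset.mul_sum, Finset.sum_mul]
  refine Finset.sum_congr rfl fun s _ => ?_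
  rw [← hUW', Matrix.conjTranspose_mul]
  simp only [Matrix.mul_assoc]

/-- Conjugating a regular homomorphism by a block diagonal unitary. -/
theorem IsHomRep.exists_conj {α : TAlg d →ₙₐ[ℂ] TAlg d'} {S : Type} [Fintype S]
    [DecidableEq S] {π : S → Fin r → Fin r} {W : S → Matrix (Idx d') (Idx d) ℂ}
    (h : IsHomRep α π W) {U : Matrix (Idx d') (Idx d') ℂ}
    (hU : U ∈ Matrix.unitaryGroup (Idx d') ℂ) (hb : ∀ x y, U x y ≠ 0 → x.1 = y.1) :
    ∃ α' : TAlg d →ₙₐ[ℂ] TAlg d', IsRegStar α' ∧ IsHomRep α' π (fun s => U * W s) ∧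
      ∀ a, (α' a : Matrix (Idx d') (Idx d') ℂ) = U * α a * Uᴴ := by
  have hU' : Uᴴ * U = 1 := Matrix.mem_unitaryGroup_iff'.1 hU
  obtain ⟨α', h1, h2⟩ := exists_hom_of_isometries (W := fun s => U * W s) h.mono
    (fun s t => by
      rw [Matrix.conjTranspose_mul, Matrix.mul_assoc, ← Matrix.mul_assoc Uᴴ, hU', Matrix.one_mul,
        h.iso])
    (fun s x y hxy => by
      rw [Matrix.mul_apply] at hxy
      obtain ⟨z, -, hz⟩ := Finset.exists_ne_zero_of_sum_ne_zero hxy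
      rw [hb x z (left_ne_zero_of_mul hz), h.supp s z y (right_ne_zero_of_mul hz)])
  refine ⟨α', h1, h2, fun a => ?_⟩
  rw [h.eq, h2.eq, Finset.mul_sum, Finset.sum_mul]
  refine Finset.sum_congr rfl fun s _ => ?_
  rw [Matrix.conjTranspose_mul]
  simp only [Matrix.mul_assoc]

/-- Prescribed multiplicities are realised if there is enough room in the blocks. -/
theorem exists_hom_of_card_le {S : Type} [Fintype S] [DecidableEq S] {π : S → Fin r → Fin r}
    (hπ : ∀ s, Monotone (π s))
    (hc : ∀ j, Fintype.card {p : S × Idx d // π p.1 p.2.1 = j} ≤ d' j) :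
    ∃ (α : TAlg d →ₙₐ[ℂ] TAlg d') (W : S → Matrix (Idx d') (Idx d) ℂ),
      IsRegStar α ∧ IsHomRep α π W := by
  have hemb : ∀ j, Nonempty ({p : S × Idx d // π p.1 p.2.1 = j} ↪ Fin (d' j)) := fun j =>
    Function.Embedding.nonempty_of_card_le (by simpa using hc j)
  let g := fun j => (hemb j).some
  -- Each column (s, x) receives its own coordinate in block `π s x.1`, chosen by an injection
  -- within that block.
  let F : S × Idx d → Idx d' := fun p => ⟨π p.1 p.2.1, g _ ⟨p, rfl⟩⟩
  have hF : Function.Injective F := by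
    have key : ∀ (j : Fin r) (p q : S × Idx d) (hp : π p.1 p.2.1 = j) (hq : π q.1 q.2.1 = j),
        g j ⟨p, hp⟩ = g j ⟨q, hq⟩ → p = q := fun j p q hp hq h =>
      congrArg Subtype.val ((g j).injective h)
    have hFj : ∀ (j : Fin r) (p : S × Idx d) (hp : π p.1 p.2.1 = j), F p = ⟨j, g j ⟨p, hp⟩⟩ := by
      rintro _ p rfl
      rfl
    intro p q hpq
    have h1 : π p.1 p.2.1 = π q.1 q.2.1 := congrArg Sigma.fst hpq
    rw [hFj _ p h1, hFj _ q rfl] at hpq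
    exact key _ p q h1 rfl (eq_of_heq (Sigma.mk.inj hpq).2)
  obtain ⟨α, h1, h2⟩ := exists_hom_of_isometries (d' := d')
    (W := fun s => Matrix.of fun k x => if k = F (s, x) then (1 : ℂ) else 0) hπ
    (fun s t => by
      ext x y
      rw [Matrix.mul_apply, Finset.sum_eq_single (F (s, x))]
      · by_cases hst : s = t
        · subst hst
          simp [Matrix.one_apply, hF.eq_iff]
        · simp [hst, hF.eq_iff]
      · intro k _ hk
        simp [hk]
      · simp)
    (fun s x y hxy => by
      by_cases h : x = F (s, y)
      · rw [h]
      · simp [h] at hxy)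
  exact ⟨α, _, h1, h2⟩

end RegularHoms

/-! ## Multiplicities are determined on the level of groups -/

section Multiplicities

theorem exists_equiv_of_card_fibers {S S' T : Type} [Fintype S] [Fintype S'] [DecidableEq T]
    {p : S → T} {p' : S' → T}
    (h : ∀ t, Fintype.card {s // p s = t} = Fintype.card {s // p' s = t}) :
    ∃ σ : S ≃ S', ∀ s, p' (σ s) = p s := by
  let e := fun t => Fintype.equivOfCardEq (h t)
  refine ⟨(Equiv.sigmaFiberEquiv p).symm.trans
    ((Equiv.sigmaCongrRight e).trans (Equiv.sigmaFiberEquiv p')), fun s => ?_⟩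
  exact (e (p s) ⟨s, rfl⟩).2

/-- A monotone family of maps `{1, 2} → {1, 2}` or `{1, 2, 3} → {1, 2, 3}` is determined by the
distribution of its values at pairs. -/
theorem exists_equiv_of_pair_counts {r : ℕ} (hr : r = 2 ∨ r = 3) {S S' : Type} [Fintype S]
    [Fintype S'] {π : S → Fin r → Fin r} {π' : S' → Fin r → Fin r} (hπ : ∀ s, Monotone (π s))
    (hπ' : ∀ s, Monotone (π' s))
    (h : ∀ i j a b : Fin r, i ≤ j → a ≤ b → (∑ s, if π s i = a ∧ π s j = b then 1 else 0 : ℤ) =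
      ∑ s, if π' s i = a ∧ π' s j = b then 1 else 0) :
    ∃ σ : S ≃ S', ∀ s, π' (σ s) = π s := by
  refine exists_equiv_of_card_fibers fun p => ?_
  by_cases hp : Monotone p
  swap
  · have h1 : IsEmpty {s // π s = p} := ⟨fun s => hp (s.2 ▸ hπ s)⟩
    have h2 : IsEmpty {s // π' s = p} := ⟨fun s => hp (s.2 ▸ hπ' s)⟩
    rw [Fintype.card_eq_zero, Fintype.card_eq_zero]
  rw [Fintype.card_subtype, Fintype.card_subtype]
  zify
  rw [Finset.natCast_card_filter, Finset.natCast_card_filter]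
  rcases hr with rfl | rfl
  · have e : ∀ q : Fin 2 → Fin 2, q = p ↔ q 0 = p 0 ∧ q 1 = p 1 := fun q => by
      rw [funext_iff, Fin.forall_fin_two]
    simp only [e]
    exact h 0 1 _ _ (by decide) (hp (by decide))
  · have e : ∀ q : Fin 3 → Fin 3, q = p ↔ q 0 = p 0 ∧ q 1 = p 1 ∧ q 2 = p 2 := fun q => by
      rw [funext_iff, Fin.forall_fin_succ, Fin.forall_fin_two]
      rfl
    simp only [e]
    have h01 : p 0 ≤ p 1 := hp (by decide)
    have h12 : p 1 ≤ p 2 := hp (by decide)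
    generalize p 0 = a at h01
    generalize p 1 = b at h01 h12
    generalize p 2 = c at h12
    -- `D F` says that the two families give F the same total. It is stable under differences and
    -- sees F only on monotone triples, so the identities below are finite checks.
    obtain ⟨D, hD⟩ : ∃ D : (Fin 3 → Fin 3 → Fin 3 → ℤ) → Prop, ∀ F, D F ↔
        ∑ s, F (π s 0) (π s 1) (π s 2) = ∑ s, F (π' s 0) (π' s 1) (π' s 2) :=
      ⟨_, fun _ => Iff.rfl⟩
    have hsub : ∀ F F', D F → D F' → D fun a b c => F a b c - F' a b c := by
      intro F F' hF hF'
      simp only [hD, Finset.sum_sub_distrib] at hF hF' ⊢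
      rw [hF, hF']
    have hcongr : ∀ F F' : Fin 3 → Fin 3 → Fin 3 → ℤ,
        (∀ a b c, a ≤ b → b ≤ c → F a b c = F' a b c) → D F → D F' := by
      intro F F' hFF hF
      refine (hD _).2 (Eq.trans ?_ (((hD _).1 hF).trans ?_))
      · exact Finset.sum_congr rfl fun s _ =>
          (hFF _ _ _ (hπ s (by decide)) (hπ s (by decide))).symm
      · exact Finset.sum_congr rfl fun s _ =>
          hFF _ _ _ (hπ' s (by decide)) (hπ' s (by decide))
    have d01 : ∀ a b, a ≤ b → D fun x y _ => if x = a ∧ y = b then 1 else 0 := fun a b hab =>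
      (hD _).2 (h 0 1 a b (by decide) hab)
    have d12 : ∀ a b, a ≤ b → D fun _ x y => if x = a ∧ y = b then 1 else 0 := fun a b hab =>
      (hD _).2 (h 1 2 a b (by decide) hab)
    have d02 : ∀ a b, a ≤ b → D fun x _ y => if x = a ∧ y = b then 1 else 0 := fun a b hab =>
      (hD _).2 (h 0 2 a b (by decide) hab)
    -- Value 0 at 0 and 1 at 2 leaves the triples 001 and 011; value 0 at 1 and 1 at 2 leaves only
    -- 001. The difference isolates 011.
    have d011 :=
      hsub _ _ (d02 0 1 (by decide)) (d12 0 1 (by decide))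
    refine (hD fun x y z => if x = a ∧ y = b ∧ z = c then 1 else 0).1 ?_
    -- A middle value 0 forces a = 0 and a middle value 2 forces c = 2, so one pair count suffices
    -- there. For middle value 1: 012 is the count of 01* minus 011, 111 is the count of 1*1, and
    -- 112 is the count of 1*2 minus that of 12*.
    fin_cases b
    · obtain rfl : a = 0 := Fin.le_zero_iff.1 h01
      refine hcongr _ _ ?_ (d12 0 c h12)
      revert c
      decide
    · fin_cases a
      · fin_cases c
        · exact absurd h12 (by decide)
        · exact hcongr _ _ (by decide) d011
        · exact hcongr _ _ (by decide) (hsub _ _ (d01 0 1 (by decide)) d011)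
      · fin_cases c
        · exact absurd h12 (by decide)
        · exact hcongr _ _ (by decide) (d02 1 1 (by decide))
        · exact hcongr _ _ (by decide) (hsub _ _ (d02 1 2 (by decide)) (d01 1 2 (by decide)))
      · exact absurd h01 (by decide)
    · obtain rfl : c = 2 := le_antisymm (Fin.le_last c) h12
      refine hcongr _ _ ?_ (d01 a 2 h01)
      revert a
      decide

variable {r : ℕ} {d d' : Fin r → ℕ+}

theorem edgeMap_eq_iff {p : Fin r → Fin r} (hp : Monotone p) (e ε : Edge r) :
    edgeMap p hp e = ε ↔ p e.1.1 = ε.1.1 ∧ p e.1.2 = ε.1.2 := by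
  rw [Subtype.ext_iff, Prod.ext_iff]
  rfl

theorem IsHomRep.edgeCount_Gmap {α : TAlg d →ₙₐ[ℂ] TAlg d'} {S : Type} [Fintype S] [DecidableEq S]
    {π : S → Fin r → Fin r} {W : S → Matrix (Idx d') (Idx d) ℂ} (h : IsHomRep α π W)
    (hα : IsRegStar α) (e ε : Edge r) :
    edgeCount ε (Gmap α hα (edgeCls d e)) =
      ∑ s, if π s e.1.1 = ε.1.1 ∧ π s e.1.2 = ε.1.2 then 1 else 0 := by
  rw [h.Gmap_edgeCls, map_sum]
  refine Finset.sum_congr rfl fun s _ => ?_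
  rw [edgeCount_edgeCls]
  simp only [edgeMap_eq_iff]

/-- Regular homomorphisms with the same action on `G` are conjugate. -/
theorem exists_unitary_of_Gmap_eq (hr : r = 2 ∨ r = 3) {α α' : TAlg d →ₙₐ[ℂ] TAlg d'}
    (hα : IsRegStar α) (hα' : IsRegStar α')
    (h : ∀ e, Gmap α hα (edgeCls d e) = Gmap α' hα' (edgeCls d e)) :
    ∃ U ∈ Matrix.unitaryGroup (Idx d') ℂ, (∀ x y, U x y ≠ 0 → x.1 = y.1) ∧
      ∀ a, (α' a : Matrix (Idx d') (Idx d') ℂ) = U * α a * Uᴴ := by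
  have : NeZero r := ⟨by omega⟩
  obtain ⟨k, π, W, hW⟩ := hα.exists_isHomRep
  obtain ⟨k', π', W', hW'⟩ := hα'.exists_isHomRep
  obtain ⟨σ, hσ⟩ := exists_equiv_of_pair_counts hr hW.mono hW'.mono fun i j a b hij hab => by
    have h1 := congrArg (edgeCount ⟨(a, b), hab⟩) (h ⟨(i, j), hij⟩)
    rw [hW.edgeCount_Gmap, hW'.edgeCount_Gmap] at h1
    exact_mod_cast h1
  exact hW.exists_unitary hW' σ hσ

end Multiplicities

/-! ### Functoriality of the group, the scale and the matrix unit scale -/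

section Functoriality

variable {r : ℕ} {d d' d'' : Fin r → ℕ+}

theorem Gmap_comp {β : TAlg d' →ₙₐ[ℂ] TAlg d''} {α : TAlg d →ₙₐ[ℂ] TAlg d'} (hβ : IsRegStar β)
    (hα : IsRegStar α) (h : IsRegStar (β.comp α)) (x : G (TAlg d)) :
    Gmap (β.comp α) h x = Gmap β hβ (Gmap α hα x) := by
  have e : Gmap (β.comp α) h = (Gmap β hβ).comp (Gmap α hα) := G_hom_ext fun v => by
    rw [AddMonoidHom.comp_apply, Gmap_clsPi, Gmap_clsPi, Gmap_clsPi]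
    rfl
  rw [e, AddMonoidHom.comp_apply]

theorem Gmap_congr {α α' : TAlg d →ₙₐ[ℂ] TAlg d'} (h : α = α') (hα : IsRegStar α)
    (hα' : IsRegStar α') (x : G (TAlg d)) : Gmap α hα x = Gmap α' hα' x := by
  subst h
  rfl

theorem Gmap_id (h : IsRegStar (NonUnitalAlgHom.id ℂ (TAlg d))) :
    Gmap _ h = AddMonoidHom.id _ :=
  G_hom_ext fun v => by
    rw [Gmap_clsPi]
    rfl

theorem Gmap_mem_scale {α : TAlg d →ₙₐ[ℂ] TAlg d'} (hα : IsRegStar α) {x : G (TAlg d)}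
    (hx : x ∈ scale (TAlg d)) : Gmap α hα x ∈ scale (TAlg d') := by
  obtain ⟨v, hv, rfl⟩ := hx
  refine ⟨α v, hv.map hα, ?_⟩
  rw [cls, Gmap_clsPi]
  rfl

/-- T_r is itself a `T_r`-algebra, with all blocks of size one, and the classes of its e_ij are its
edge classes. -/
theorem mem_muScale_iff {s : Edge r → G (TAlg d)} : s ∈ muScale d ↔
    ∃ (φ : Tri r →ₙₐ[ℂ] TAlg d) (hφ : IsRegStar φ), s = fun e => Gmap φ hφ (edgeCls _ e) := by
  have key : ∀ (φ : Tri r →ₙₐ[ℂ] TAlg d) (hφ : IsRegStar φ) (e : Edge r),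
      Gmap φ hφ (edgeCls _ e) = cls (φ (unit e)) (isRegPisom_map_unit hφ e) := by
    intro φ hφ e
    rw [edgeCls, cls, Gmap_clsPi]
    rfl
  simp only [key]
  rfl

theorem Gmap_mem_muScale {α : TAlg d →ₙₐ[ℂ] TAlg d'} (hα : IsRegStar α) {s : Edge r → G (TAlg d)}
    (hs : s ∈ muScale d) : (fun e => Gmap α hα (s e)) ∈ muScale d' := by
  rw [mem_muScale_iff] at hs ⊢
  obtain ⟨φ, hφ, rfl⟩ := hs
  exact ⟨α.comp φ, hα.comp hφ, funext fun e => (Gmap_comp hα hφ _ _).symm⟩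

/-- Realised by an embedding of T_r which uses one coordinate of each block; there is room because
blocks are nonempty. -/
theorem edgeCls_mem_muScale : edgeCls d ∈ muScale d := by
  rw [mem_muScale_iff]
  obtain ⟨φ, W, hφ, hW⟩ := exists_hom_of_card_le (d := fun _ : Fin r => 1) (d' := d)
    (π := fun _ : Unit => id) (fun _ => monotone_id) (fun j => by
      refine le_trans (Fintype.card_le_one_iff.2 ?_) (Nat.succ_le_of_lt (d j).pos)
      rintro ⟨⟨_, i, a⟩, rfl⟩ ⟨⟨_, i', a'⟩, h⟩
      obtain rfl : i' = i := h
      obtain rfl : a = a' := Subsingleton.elim (α := Fin 1) _ _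
      rfl)
  refine ⟨φ, hφ, funext fun e => ?_⟩
  rw [hW.Gmap_edgeCls]
  simp [edgeMap]

end Functoriality

/-! ## Direct systems -/

namespace RegSystem

variable {r : ℕ} (S S' : RegSystem r)

theorem trans_self (m : ℕ) : S.trans (le_refl m) = NonUnitalAlgHom.id ℂ (S.alg m) :=
  Nat.leRecOn_self _

theorem trans_succ {m n : ℕ} (h : m ≤ n) (h' : m ≤ n + 1) :
    S.trans h' = (S.map n).comp (S.trans h) :=
  Nat.leRecOn_succ h _

theorem isRegStar_trans {m n : ℕ} (h : m ≤ n) : IsRegStar (S.trans h) := by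
  induction n, h using Nat.le_induction with
  | base =>
    rw [trans_self]
    exact isRegStar_id _
  | succ n h ih =>
    rw [S.trans_succ h]
    exact (S.isRegStar n).comp ih

theorem trans_comp_trans {l m n : ℕ} (h : l ≤ m) (h' : m ≤ n) :
    (S.trans h').comp (S.trans h) = S.trans (h.trans h') := by
  induction n, h' using Nat.le_induction with
  | base =>
    rw [trans_self]
    rfl
  | succ n h' ih =>
    rw [S.trans_succ h', S.trans_succ (h.trans h'), ← ih]
    rfl

theorem gTrans_apply {m n : ℕ} (h : m ≤ n) (x : G (S.alg m)) :
    S.gTrans m n h x = Gmap (S.trans h) (S.isRegStar_trans h) x := by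
  have key : S.gTrans m n h = Gmap (S.trans h) (S.isRegStar_trans h) := by
    induction n, h using Nat.le_induction with
    | base =>
      have h1 : ∀ (f : S.alg m →ₙₐ[ℂ] S.alg m) (hf : IsRegStar f),
          f = NonUnitalAlgHom.id ℂ (S.alg m) → Gmap f hf = AddMonoidHom.id _ := by
        rintro _ hf rfl
        exact Gmap_id hf
      rw [h1 _ _ (S.trans_self m)]
      exact Nat.leRecOn_self _
    | succ n h ih =>
      have h1 : S.gTrans m (n + 1) (h.trans n.le_succ) =
          (Gmap (S.map n) (S.isRegStar n)).comp (S.gTrans m n h) := Nat.leRecOn_succ h _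
      rw [h1, ih]
      ext x
      rw [AddMonoidHom.comp_apply, ← Gmap_comp _ _ ((S.isRegStar n).comp (S.isRegStar_trans h))]
      exact Gmap_congr (S.trans_succ h _).symm _ _ x
  rw [key]

instance : DirectedSystem (fun k => G (S.alg k)) fun i j h => S.gTrans i j h where
  map_self i x := by
    rw [show S.gTrans i i le_rfl = AddMonoidHom.id _ from Nat.leRecOn_self _]
    rfl
  map_map i j k hij hjk x := by
    rw [gTrans_apply, gTrans_apply, gTrans_apply,
      ← Gmap_comp _ _ ((S.isRegStar_trans hjk).comp (S.isRegStar_trans hij))]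
    exact Gmap_congr (S.trans_comp_trans hij hjk) _ _ x

theorem toGLim_gTrans {m n : ℕ} (h : m ≤ n) (x : G (S.alg m)) :
    S.toGLim n (S.gTrans m n h x) = S.toGLim m x :=
  AddCommGroup.DirectLimit.of_f (G := fun k => G (S.alg k)) (f := S.gTrans) h x

theorem toGLim_Gmap_trans {m n : ℕ} (h : m ≤ n) (x : G (S.alg m)) :
    S.toGLim n (Gmap (S.trans h) (S.isRegStar_trans h) x) = S.toGLim m x := by
  rw [← gTrans_apply, toGLim_gTrans]

/-- Finitely many equalities in the limit group hold at a finite stage. -/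
theorem exists_stage_eq {T : Type} (t : Finset T) {k l : ℕ} {x : T → G (S.alg k)}
    {y : T → G (S.alg l)} (h : ∀ e, S.toGLim k (x e) = S.toGLim l (y e)) (b : ℕ) :
    ∃ (N : ℕ) (hk : k ≤ N) (hl : l ≤ N), b ≤ N ∧ ∀ e ∈ t,
      Gmap (S.trans hk) (S.isRegStar_trans hk) (x e) =
        Gmap (S.trans hl) (S.isRegStar_trans hl) (y e) := by
  simp only [← gTrans_apply]
  classical
  induction t using Finset.induction_on with
  | empty => exact ⟨max b (max k l), by omega, by omega, by omega, by simp⟩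
  | insert e t _ ih =>
    obtain ⟨N, hk, hl, hb, hN⟩ := ih
    have h0 : S.toGLim N (S.gTrans k N hk (x e) - S.gTrans l N hl (y e)) = 0 := by
      rw [map_sub, sub_eq_zero, toGLim_gTrans, toGLim_gTrans, h]
    obtain ⟨N', hN', h1⟩ := AddCommGroup.DirectLimit.of.zero_exact N _ h0
    have hmap : ∀ (i : ℕ) (hi : i ≤ N) (z : G (S.alg i)),
        S.gTrans i N' (hi.trans hN') z = S.gTrans N N' hN' (S.gTrans i N hi z) := fun i hi z =>
      (DirectedSystem.map_map (F := fun k => G (S.alg k)) (f := fun i j h => S.gTrans i j h)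
        hi hN' z).symm
    refine ⟨N', hk.trans hN', hl.trans hN', hb.trans hN', fun e' he' => ?_⟩
    rw [hmap k hk, hmap l hl]
    rcases Finset.mem_insert.1 he' with rfl | he'
    · rw [map_sub, sub_eq_zero] at h1
      exact h1
    · rw [hN e' he']

/-! ### Isomorphisms of invariants and commuting ladders -/

variable {S S'}

/-- The matrix unit scale turns the images under Φ of the edge classes of A_k into a homomorphism ρ
from T_r, and the scale bounds the image of the class of the identity. Both facts are brought to a
common stage N. -/
theorem exists_lift [NeZero r] {Φ : S.GLim →+ S'.GLim}
    (hs : ∀ x ∈ S.scaleLim, Φ x ∈ S'.scaleLim)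
    (hm : ∀ s ∈ S.muScaleLim, (fun e => Φ (s e)) ∈ S'.muScaleLim) (k : ℕ) :
    ∃ (m : ℕ) (φ : S.alg k →ₙₐ[ℂ] S'.alg m) (hφ : IsRegStar φ),
      ∀ x, S'.toGLim m (Gmap φ hφ x) = Φ (S.toGLim k x) := by
  obtain ⟨m₁, hmu⟩ := Set.mem_iUnion.1 (hm (fun e => S.toGLim k (edgeCls (S.dim k) e))
    (Set.mem_iUnion.2 ⟨k, _, edgeCls_mem_muScale, rfl⟩))
  obtain ⟨s, hs1, hs2⟩ := hmu
  obtain ⟨ρ, hρ, rfl⟩ := mem_muScale_iff.1 hs1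
  obtain ⟨m₂, hsc⟩ := Set.mem_iUnion.1 (hs _ (Set.mem_iUnion.2 ⟨k, _,
    sum_edgeCls_mem_scale (d := S.dim k), rfl⟩))
  obtain ⟨g, hg, hg'⟩ := hsc
  have hlim : S'.toGLim m₁ (∑ x : Idx (S.dim k), Gmap ρ hρ (edgeCls _ ⟨(x.1, x.1), le_rfl⟩)) =
      S'.toGLim m₂ g := by
    rw [hg', map_sum, map_sum, map_sum]
    exact Finset.sum_congr rfl fun x _ => congrFun hs2 _
  obtain ⟨N, h1, h2, -, hN⟩ := S'.exists_stage_eq (T := Unit) {()} (x := fun _ => _)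
    (y := fun _ => _) (fun _ => hlim) 0
  have hN := hN () (Finset.mem_singleton_self _)
  have hρ' := (S'.isRegStar_trans h1).comp hρ
  obtain ⟨n, π, W, hW⟩ := hρ'.exists_isHomRep
  -- The maps π of ρ are kept and the domain T_r is replaced by A_k. The coordinates sent to block j
  -- number the (j, j) multiplicity of the image of the identity class, which now equals that of a
  -- scale element.
  obtain ⟨φ, V, hφ, hV⟩ := exists_hom_of_card_le (d := S.dim k) (d' := S'.dim N) hW.mono
    fun j => by
      obtain ⟨c, hc, hc'⟩ := edgeCount_le_of_mem_scale (Gmap_mem_scale (S'.isRegStar_trans h2) hg) j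
      rw [← hN, map_sum, map_sum] at hc
      simp only [← Gmap_comp _ _ hρ', hW.edgeCount_Gmap, and_self] at hc
      refine le_of_eq_of_le ?_ hc'
      rw [Fintype.card_subtype, Finset.card_filter]
      rw [Finset.sum_comm, ← Fintype.sum_prod_type'
        (f := fun (s : Fin n) (x : Idx (S.dim k)) => if π s x.1 = j then (1 : ℂ) else 0)] at hc
      exact_mod_cast hc
  refine ⟨N, φ, hφ, ?_⟩
  have key : (S'.toGLim N).comp (Gmap φ hφ) = Φ.comp (S.toGLim k) := G_hom_ext_edge fun e => by
    have h3 := hW.Gmap_edgeCls hρ' e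
    rw [AddMonoidHom.comp_apply, hV.Gmap_edgeCls, ← h3, Gmap_comp (S'.isRegStar_trans h1) hρ,
      toGLim_Gmap_trans]
    exact congrFun hs2 e
  exact fun x => DFunLike.congr_fun key x

/-- One step of the intertwining. -/
theorem exists_intertwiner (hr : r = 2 ∨ r = 3) {Φ : S.GLim →+ S'.GLim} {Ψ : S'.GLim →+ S.GLim}
    (hΨΦ : ∀ x, Ψ (Φ x) = x) (hs : ∀ x ∈ S'.scaleLim, Ψ x ∈ S.scaleLim)
    (hm : ∀ s ∈ S'.muScaleLim, (fun e => Ψ (s e)) ∈ S.muScaleLim) {n m : ℕ}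
    {φ : S.alg n →ₙₐ[ℂ] S'.alg m} (hφ : IsRegStar φ)
    (h : ∀ x, S'.toGLim m (Gmap φ hφ x) = Φ (S.toGLim n x)) :
    ∃ (n' : ℕ) (hn : n < n') (ψ : S'.alg m →ₙₐ[ℂ] S.alg n') (hψ : IsRegStar ψ),
      ψ.comp φ = S.trans hn.le ∧ ∀ x, S.toGLim n' (Gmap ψ hψ x) = Ψ (S'.toGLim m x) := by
  have : NeZero r := ⟨by omega⟩
  obtain ⟨n₁, ψ₁, hψ₁, h₁⟩ := exists_lift hs hm m
  -- There are finitely many edges, so agreement in the limit holds at a finite stage; the bound `n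
  -- + 1` makes the new index strictly larger.
  obtain ⟨N, ha, hb, hlt, hN⟩ := S.exists_stage_eq (T := Edge r) Finset.univ
    (x := fun e => Gmap ψ₁ hψ₁ (Gmap φ hφ (edgeCls _ e))) (y := fun e => edgeCls (S.dim n) e)
    (fun e => by rw [h₁, h, hΨΦ]) (n + 1)
  have hψ₂ := (S.isRegStar_trans ha).comp hψ₁
  obtain ⟨U, hU, hUb, hUa⟩ := exists_unitary_of_Gmap_eq hr (hψ₂.comp hφ) (S.isRegStar_trans hb)
    fun e => by
      rw [Gmap_comp hψ₂ hφ, Gmap_comp (S.isRegStar_trans ha) hψ₁]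
      exact hN e (Finset.mem_univ e)
  obtain ⟨k, π, W, hW⟩ := hψ₂.exists_isHomRep
  -- Conjugation by U makes the triangle commute exactly and keeps the maps π, hence the induced map
  -- on G.
  obtain ⟨ψ, hψ, hψW, hψU⟩ := hW.exists_conj hU hUb
  refine ⟨N, hlt, ψ, hψ, ?_, ?_⟩
  · ext1 a
    refine Subtype.ext ?_
    rw [hUa]
    exact hψU (φ a)
  · have key : (S.toGLim N).comp (Gmap ψ hψ) = Ψ.comp (S'.toGLim m) := G_hom_ext_edge fun e => by
      rw [AddMonoidHom.comp_apply, hψW.Gmap_edgeCls, ← hW.Gmap_edgeCls hψ₂,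
        Gmap_comp (S.isRegStar_trans ha) hψ₁, toGLim_Gmap_trans, h₁]
      rfl
    exact fun x => DFunLike.congr_fun key x

/-- A regular homomorphism between algebras of two systems which induces the restriction of a
given homomorphism of the limit groups. -/
structure Rung (Φ : S.GLim →+ S'.GLim) where
  /-- the index of the domain -/
  src : ℕ
  /-- the index of the codomain -/
  tgt : ℕ
  /-- the homomorphism -/
  hom : S.alg src →ₙₐ[ℂ] S'.alg tgt
  isRegStar : IsRegStar hom
  induces : ∀ x, S'.toGLim tgt (Gmap hom isRegStar x) = Φ (S.toGLim src x)

/-- The rung `t'` succeeds the rung `t` in a commuting ladder. -/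
structure Rung.Next {Φ : S.GLim →+ S'.GLim} (t t' : Rung Φ) where
  src_lt : t.src < t'.src
  tgt_lt : t.tgt < t'.tgt
  /-- the diagonal homomorphism -/
  diag : S'.alg t.tgt →ₙₐ[ℂ] S.alg t'.src
  isRegStar : IsRegStar diag
  diag_comp : diag.comp t.hom = S.trans src_lt.le
  comp_diag : t'.hom.comp diag = S'.trans tgt_lt.le

/-- Back and forth: each new rung uses `exists_intertwiner` twice, the second time with the two
systems exchanged. -/
theorem regIso_of_mutually_inverse (hr : r = 2 ∨ r = 3) {Φ : S.GLim →+ S'.GLim}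
    {Ψ : S'.GLim →+ S.GLim} (hΨΦ : ∀ x, Ψ (Φ x) = x) (hΦΨ : ∀ x, Φ (Ψ x) = x)
    (hs : ∀ x ∈ S.scaleLim, Φ x ∈ S'.scaleLim) (hs' : ∀ x ∈ S'.scaleLim, Ψ x ∈ S.scaleLim)
    (hm : ∀ s ∈ S.muScaleLim, (fun e => Φ (s e)) ∈ S'.muScaleLim)
    (hm' : ∀ s ∈ S'.muScaleLim, (fun e => Ψ (s e)) ∈ S.muScaleLim) : RegIso S S' := by
  have : NeZero r := ⟨by omega⟩
  have step : ∀ t : Rung Φ, ∃ t' : Rung Φ, Nonempty (t.Next t') := by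
    intro t
    obtain ⟨n', hn, ψ, hψ, e, h'⟩ := exists_intertwiner hr hΨΦ hs' hm' t.isRegStar t.induces
    obtain ⟨m', hm, φ', hφ', e', h''⟩ := exists_intertwiner hr hΦΨ hs hm hψ h'
    exact ⟨⟨n', m', φ', hφ', h''⟩, ⟨hn, hm, ψ, hψ, e, e'⟩⟩
  choose next hnext using step
  obtain ⟨m₀, φ₀, hφ₀, h₀⟩ := exists_lift hs hm 0
  let seq : ℕ → Rung Φ := fun k => Nat.rec ⟨0, m₀, φ₀, hφ₀, h₀⟩ (fun _ t => next t) k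
  let D : ∀ k, (seq k).Next (seq (k + 1)) := fun k => (hnext (seq k)).some
  exact ⟨fun k => (seq k).src, fun k => (seq k).tgt,
    strictMono_nat_of_lt_succ fun k => (D k).src_lt,
    strictMono_nat_of_lt_succ fun k => (D k).tgt_lt, fun k => (seq k).hom, fun k => (D k).diag, rfl,
    fun k => (seq k).isRegStar, fun k => (D k).isRegStar, fun k => (D k).diag_comp,
    fun k => (D k).comp_diag⟩

theorem regIso_of_isInvariantIso (hr : r = 2 ∨ r = 3) {Φ : S.GLim ≃+ S'.GLim}
    (hΦ : IsInvariantIso S S' Φ) : RegIso S S' := by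
  have hs : ∀ x ∈ S.scaleLim, Φ.toAddMonoidHom x ∈ S'.scaleLim := fun x hx => by
    rw [← hΦ.map_scale]
    exact Set.mem_image_of_mem Φ hx
  have hs' : ∀ x ∈ S'.scaleLim, Φ.symm.toAddMonoidHom x ∈ S.scaleLim := fun x hx => by
    rw [← hΦ.map_scale] at hx
    obtain ⟨y, hy, rfl⟩ := hx
    rw [show Φ.symm.toAddMonoidHom (Φ y) = y from Φ.symm_apply_apply y]
    exact hy
  have hm : ∀ s ∈ S.muScaleLim, (fun e => Φ.toAddMonoidHom (s e)) ∈ S'.muScaleLim := fun s hs => by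
    rw [← hΦ.map_muScale]
    exact Set.mem_image_of_mem (fun s e => Φ (s e)) hs
  have hm' : ∀ s ∈ S'.muScaleLim, (fun e => Φ.symm.toAddMonoidHom (s e)) ∈ S.muScaleLim :=
    fun s hs => by
      rw [← hΦ.map_muScale] at hs
      obtain ⟨y, hy, rfl⟩ := hs
      rw [show (fun e => Φ.symm.toAddMonoidHom (Φ (y e))) = y from
        funext fun e => Φ.symm_apply_apply (y e)]
      exact hy
  exact regIso_of_mutually_inverse hr (fun x => Φ.symm_apply_apply x)
    (fun x => Φ.apply_symm_apply x) hs hs' hm hm'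

/-- Regular homomorphisms which intertwine the maps of two systems induce a homomorphism of the
limit groups which respects the scales. -/
theorem exists_limit_hom {n m : ℕ → ℕ} (hn : StrictMono n) (hm : StrictMono m)
    {φ : ∀ k, S.alg (n k) →ₙₐ[ℂ] S'.alg (m k)} (hφ : ∀ k, IsRegStar (φ k))
    (h : ∀ k, (φ (k + 1)).comp (S.trans (hn k.lt_succ_self).le) =
      (S'.trans (hm k.lt_succ_self).le).comp (φ k)) :
    ∃ F : S.GLim →+ S'.GLim, (∀ k x, F (S.toGLim (n k) x) = S'.toGLim (m k) (Gmap (φ k) (hφ k) x)) ∧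
      (∀ x ∈ S.scaleLim, F x ∈ S'.scaleLim) ∧
      ∀ s ∈ S.muScaleLim, (fun e => F (s e)) ∈ S'.muScaleLim := by
  have hstep : ∀ k x, S'.toGLim (m (k + 1)) (Gmap (φ (k + 1)) (hφ (k + 1))
      (Gmap _ (S.isRegStar_trans (hn k.lt_succ_self).le) x)) =
      S'.toGLim (m k) (Gmap (φ k) (hφ k) x) := by
    intro k x
    rw [← Gmap_comp _ _ ((hφ (k + 1)).comp (S.isRegStar_trans _)),
      ← S'.toGLim_Gmap_trans (hm k.lt_succ_self).le,
      ← Gmap_comp _ _ ((S'.isRegStar_trans _).comp (hφ k))]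
    exact congrArg _ (Gmap_congr (h k) _ _ x)
  have hind : ∀ {i k l : ℕ} (hi : i ≤ n k) (hkl : k ≤ l) (x : G (S.alg i)),
      S'.toGLim (m l) (Gmap (φ l) (hφ l)
        (S.gTrans i (n l) (hi.trans (hn.monotone hkl)) x)) =
      S'.toGLim (m k) (Gmap (φ k) (hφ k) (S.gTrans i (n k) hi x)) := by
    intro i k l hi hkl x
    induction l, hkl using Nat.le_induction with
    | base => rfl
    | succ l hkl ih =>
      rw [← ih, ← hstep l, ← gTrans_apply]
      refine congrArg (fun z => S'.toGLim _ (Gmap _ (hφ _) z)) ?_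
      exact (DirectedSystem.map_map (F := fun k => G (S.alg k)) (f := fun i j h => S.gTrans i j h)
        (hi.trans (hn.monotone hkl)) (hn l.lt_succ_self).le x).symm
  -- Strict monotonicity gives i ≤ n i, so stage i can be pushed to `n i` and sent across by `φ i`;
  -- `hind` shows that later rungs give the same value.
  let g : ∀ i, G (S.alg i) →+ S'.GLim := fun i =>
    ((S'.toGLim (m i)).comp (Gmap (φ i) (hφ i))).comp (S.gTrans i (n i) hn.le_apply)
  have hg : ∀ i j hij x, g j (S.gTrans i j hij x) = g i x := by
    intro i j hij x
    refine Eq.trans ?_ (hind hn.le_apply hij x)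
    refine congrArg (fun z => S'.toGLim (m j) (Gmap (φ j) (hφ j) z)) ?_
    exact DirectedSystem.map_map (F := fun k => G (S.alg k)) (f := fun i j h => S.gTrans i j h)
      hij hn.le_apply x
  let F : S.GLim →+ S'.GLim :=
    AddCommGroup.DirectLimit.lift (fun k => G (S.alg k)) S.gTrans _ g hg
  have hF : ∀ i x, F (S.toGLim i x) =
      S'.toGLim (m i) (Gmap (φ i) (hφ i) (S.gTrans i (n i) hn.le_apply x)) := fun i x =>
    AddCommGroup.DirectLimit.lift_of (G := fun k => G (S.alg k)) (f := S.gTrans) _ g hg i x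
  refine ⟨F, fun k x => ?_, ?_, ?_⟩
  · rw [hF, hind le_rfl hn.le_apply x]
    refine congrArg (fun z => S'.toGLim _ (Gmap _ (hφ _) z)) ?_
    exact DirectedSystem.map_self (F := fun k => G (S.alg k)) (f := fun i j h => S.gTrans i j h) x
  · intro x hx
    obtain ⟨i, y, hy, rfl⟩ := Set.mem_iUnion.1 hx
    rw [hF, gTrans_apply]
    exact Set.mem_iUnion.2 ⟨m i, _, Gmap_mem_scale _ (Gmap_mem_scale _ hy), rfl⟩
  · intro s hs
    obtain ⟨i, y, hy, rfl⟩ := Set.mem_iUnion.1 hs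
    simp only [hF, gTrans_apply]
    exact Set.mem_iUnion.2 ⟨m i, _, Gmap_mem_muScale (hφ i)
      (Gmap_mem_muScale (S.isRegStar_trans hn.le_apply) hy), rfl⟩

/-- Since i ≤ n i, every element of the limit already comes from a stage of the subsequence. -/
theorem glim_hom_ext {F : S.GLim →+ S.GLim} {n : ℕ → ℕ} (hn : StrictMono n)
    (h : ∀ k x, F (S.toGLim (n k) x) = S.toGLim (n k) x) (x : S.GLim) : F x = x := by
  induction x using AddCommGroup.DirectLimit.induction_on with
  | ih i x =>
    change F (S.toGLim i x) = S.toGLim i x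
    rw [← S.toGLim_Gmap_trans (hn.le_apply (x := i)), h]

theorem exists_isInvariantIso_of_regIso (h : RegIso S S') :
    ∃ Φ : S.GLim ≃+ S'.GLim, IsInvariantIso S S' Φ := by
  obtain ⟨n, m, hn, hm, φ, ψ, -, hφ, hψ, h1, h2⟩ := h
  -- The shift by one reflects that `ψ k` lands at stage `n (k + 1)`.
  have hn' : StrictMono fun k => n (k + 1) := fun i j hij => hn (Nat.succ_lt_succ hij)
  obtain ⟨F, hF, hFs, hFm⟩ := exists_limit_hom hn hm hφ fun k => by
    rw [← h1, ← h2]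
    rfl
  obtain ⟨E, hE, hEs, hEm⟩ := exists_limit_hom (S := S') (S' := S) hm hn' hψ fun k => by
    rw [← h1, ← h2]
    rfl
  have hEF : ∀ x, E (F x) = x := glim_hom_ext (F := E.comp F) hn fun k x => by
    rw [AddMonoidHom.comp_apply, hF, hE, ← Gmap_comp _ _ ((hψ k).comp (hφ k)),
      ← S.toGLim_Gmap_trans (hn k.lt_succ_self).le]
    exact congrArg _ (Gmap_congr (h1 k) _ _ x)
  have hFE : ∀ x, F (E x) = x := glim_hom_ext (F := F.comp E) hm fun k x => by
    rw [AddMonoidHom.comp_apply, hE, hF, ← Gmap_comp _ _ ((hφ (k + 1)).comp (hψ k)),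
      ← S'.toGLim_Gmap_trans (hm k.lt_succ_self).le]
    exact congrArg _ (Gmap_congr (h2 k) _ _ x)
  let Φ : S.GLim ≃+ S'.GLim :=
    { toFun := F, invFun := E, left_inv := hEF, right_inv := hFE, map_add' := map_add F }
  have hscale : Φ '' S.scaleLim = S'.scaleLim :=
    Set.Subset.antisymm (Set.image_subset_iff.2 hFs) fun x hx => ⟨E x, hEs x hx, hFE x⟩
  refine ⟨Φ, ?_, hscale, ?_⟩
  -- The cone is generated by the scale, so it is preserved once the scale is.
  · have h3 : S.coneLim.map Φ.toAddMonoidHom = S'.coneLim := by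
      rw [coneLim, coneLim, AddMonoidHom.map_mclosure]
      exact congrArg AddSubmonoid.closure hscale
    rw [← h3]
    rfl
  · exact Set.Subset.antisymm (Set.image_subset_iff.2 hFm) fun s hs =>
      ⟨fun e => E (s e), hEm s hs, funext fun e => hFE _⟩

end RegSystem

end DimDist

end

theorem mainTheorem3 (r : ℕ) (hr : r = 2 ∨ r = 3) (S S' : DimDist.RegSystem r) :
    DimDist.RegSystem.RegIso S S' ↔
      ∃ Φ : S.GLim ≃+ S'.GLim, DimDist.RegSystem.IsInvariantIso S S' Φ :=
  ⟨DimDist.RegSystem.exists_isInvariantIso_of_regIso, fun ⟨_, hΦ⟩ =>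
    DimDist.RegSystem.regIso_of_isInvariantIso hr hΦ⟩
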